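/- Let $A$ be a unital simple $C^*$-algebra with a unique normalized trace $\tau$ (a positive linear functional with $\tau(1)=1$ and $\tau(ab)=\tau(ba)$). Let $Tr$ be the unnormalized trace on $M_n(\mathbb{C})$, so that $\tau\otimes Tr\,((x_{ij})_{ij})=\sum_i\tau(x_{ii})$ on $M_n(A)$, and put $$\mathcal{F}(A)=\{\tau\otimes Tr(p)\in\mathbb{R}^\times_+ \mid n\in\mathbb{N},\ p \text{ is a projection in } M_n(A) \text{ such that } pM_n(A)p\cong A\}.$$ Let $K(\mathcal{H})$ be the $C^*$-algebra of compact operators on $\mathcal{H}=\ell^2(\mathbb{N})$, so that $A\otimes K(\mathcal{H})$ is the $C^*$-completion of $\bigcup_n M_n(A)$, where $M_n(A)\subset M_{n+1}(A)$ as the upper left corner, and let $1_n$ be the unit of $M_n(A)$. For $x\in (A\otimes K(\mathcal{H}))_+$ put $$\hat\tau(x)=\sup_n\ \tau\otimes Tr(1_n\,x\,1_n)\in[0,\infty],$$ the lower semicontinuous trace on $A\otimes K(\mathcal{H})$ that extends $\tau\otimes Tr$. Let $\mathcal{M}_\tau^+=\{x\ge 0 : \hat\tau(x)<\infty\}$ and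 $\mathcal{M}_\tau=\mathrm{span}\,\mathcal{M}_\tau^+$, and denote by $\hat\tau$ also the linear extension of $\hat\tau|_{\mathcal{M}_\tau^+}$ to $\mathcal{M}_\tau$. Put $$\mathfrak{S}(A)=\{\lambda\in\mathbb{R}^\times_+ \mid \text{there is } \alpha\in\mathrm{Aut}(A\otimes K(\mathcal{H})) \text{ such that } \alpha(x)\in\mathcal{M}_\tau \text{ and } \hat\tau(\alpha(x))=\lambda\hat\tau(x) \text{ for all } x\in\mathcal{M}_\tau\}.$$ Then $\mathcal{F}(A)=\mathfrak{S}(A)$, and this set is a multiplicative subgroup of $\mathbb{R}^\times_+$. -/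

import Mathlib

open scoped ComplexOrder ENNReal

set_option linter.unusedSectionVars false

noncomputable section

/-! ### Finitely supported infinite matrices: the union of the algebras `M_n(A)` -/

/-- Infinite matrices over `A`, indexed by `ℕ × ℕ`, with only finitely many nonzero entries. -/
def finMatSubmodule (A : Type*) [AddCommGroup A] [Module ℂ A] : Submodule ℂ (ℕ → ℕ → A) where
  carrier := {x | ∃ n, ∀ i j, n ≤ i ∨ n ≤ j → x i j = 0}
  zero_mem' := ⟨0, fun _ _ _ => rfl⟩
  add_mem' := by
    rintro x y ⟨n, hn⟩ ⟨m, hm⟩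
    refine ⟨max n m, fun i j h => ?_⟩
    have h1 : n ≤ i ∨ n ≤ j := h.imp (le_trans (le_max_left _ _)) (le_trans (le_max_left _ _))
    have h2 : m ≤ i ∨ m ≤ j := h.imp (le_trans (le_max_right _ _)) (le_trans (le_max_right _ _))
    simp [hn i j h1, hm i j h2]
  smul_mem' := by
    rintro c x ⟨n, hn⟩
    exact ⟨n, fun i j h => by simp [hn i j h]⟩

/-- The *-algebra `⋃ₙ M_n(A)`, where `M_n(A)` sits in `M_{n+1}(A)` as the upper left corner. -/
def FinMat (A : Type*) [AddCommGroup A] [Module ℂ A] : Type _ := finMatSubmodule A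

namespace FinMat

section Algebra

variable {A : Type*} [NonUnitalRing A] [StarRing A] [Module ℂ A] [IsScalarTower ℂ A A]
  [SMulCommClass ℂ A A] [StarModule ℂ A]

instance : AddCommGroup (FinMat A) := inferInstanceAs (AddCommGroup (finMatSubmodule A))
instance : Module ℂ (FinMat A) := inferInstanceAs (Module ℂ (finMatSubmodule A))

/-- The entries of a finitely supported matrix. -/
def entry (x : FinMat A) (i j : ℕ) : A := (x : finMatSubmodule A).1 i j

/-- `x` belongs to `M_n(A)`. -/
def Supp (n : ℕ) (x : FinMat A) : Prop := ∀ i j, n ≤ i ∨ n ≤ j → x.entry i j = 0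

/-- Some `n` with `x ∈ M_n(A)`. -/
def bound (x : FinMat A) : ℕ := Classical.choose (x : finMatSubmodule A).2

theorem supp_bound (x : FinMat A) : Supp x.bound x :=
  Classical.choose_spec (x : finMatSubmodule A).2

theorem Supp.mono {n m : ℕ} {x : FinMat A} (h : Supp n x) (hnm : n ≤ m) : Supp m x :=
  fun i j hij => h i j (hij.imp hnm.trans hnm.trans)

@[ext] theorem ext {x y : FinMat A} (h : ∀ i j, x.entry i j = y.entry i j) : x = y :=
  Subtype.ext (funext fun i => funext fun j => h i j)

@[simp] theorem entry_zero (i j : ℕ) : (0 : FinMat A).entry i j = 0 := rfl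
@[simp] theorem entry_add (x y : FinMat A) (i j : ℕ) :
    (x + y).entry i j = x.entry i j + y.entry i j := rfl
@[simp] theorem entry_smul (c : ℂ) (x : FinMat A) (i j : ℕ) :
    (c • x).entry i j = c • x.entry i j := rfl

/-- Matrix multiplication (the sums over `k` are finite). -/
instance : Mul (FinMat A) where
  mul x y := (⟨fun i j => ∑ᶠ k, x.entry i k * y.entry k j, by
    refine ⟨max x.bound y.bound, fun i j h => ?_⟩
    rw [← finsum_zero (α := ℕ)]
    refine finsum_congr fun k => ?_
    rcases h with h | h
    · rw [x.supp_bound i k (Or.inl ((le_max_left _ _).trans h)), zero_mul]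
    · rw [y.supp_bound k j (Or.inr ((le_max_right _ _).trans h)), mul_zero]⟩ : finMatSubmodule A)

/-- The conjugate transpose. -/
instance : Star (FinMat A) where
  star x := (⟨fun i j => star (x.entry j i), by
    refine ⟨x.bound, fun i j h => ?_⟩
    change star (x.entry j i) = 0
    rw [x.supp_bound j i h.symm, star_zero]⟩ : finMatSubmodule A)

@[simp] theorem entry_star (x : FinMat A) (i j : ℕ) :
    (star x).entry i j = star (x.entry j i) := rfl

theorem entry_mul (x y : FinMat A) (i j : ℕ) :
    (x * y).entry i j = ∑ᶠ k, x.entry i k * y.entry k j := rfl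

theorem entry_mul_eq_sum {n : ℕ} {x y : FinMat A} (h : Supp n x ∨ Supp n y) (i j : ℕ) :
    (x * y).entry i j = ∑ k : Fin n, x.entry i k * y.entry k j := by
  rw [entry_mul, Fin.sum_univ_eq_sum_range (fun k => x.entry i k * y.entry k j)]
  refine finsum_eq_sum_of_support_subset _ fun k hk => ?_
  rw [Function.mem_support] at hk
  by_contra hkn
  have hkn : n ≤ k := by simpa using hkn
  rcases h with h | h
  · exact hk (by rw [h i k (Or.inr hkn), zero_mul])
  · exact hk (by rw [h k j (Or.inl hkn), mul_zero])

theorem Supp.mul {n : ℕ} {x y : FinMat A} (hx : Supp n x) (hy : Supp n y) : Supp n (x * y) := by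
  intro i j h
  rw [entry_mul_eq_sum (Or.inl hx)]
  refine Finset.sum_eq_zero fun k _ => ?_
  rcases h with h | h
  · rw [hx i k (Or.inl h), zero_mul]
  · rw [hy k j (Or.inr h), mul_zero]

theorem Supp.add {n : ℕ} {x y : FinMat A} (hx : Supp n x) (hy : Supp n y) : Supp n (x + y) :=
  fun i j h => by rw [entry_add, hx i j h, hy i j h, add_zero]

theorem Supp.smul {n : ℕ} {x : FinMat A} (c : ℂ) (hx : Supp n x) : Supp n (c • x) :=
  fun i j h => by rw [entry_smul, hx i j h, smul_zero]

theorem Supp.star {n : ℕ} {x : FinMat A} (hx : Supp n x) : Supp n (star x) :=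
  fun i j h => by rw [entry_star, hx j i h.symm, star_zero]

/-- The upper left `n × n` corner of a finitely supported matrix. -/
def corner (n : ℕ) (x : FinMat A) : CStarMatrix (Fin n) (Fin n) A :=
  CStarMatrix.ofMatrix fun i j => x.entry i j

theorem corner_apply (n : ℕ) (x : FinMat A) (i j : Fin n) : corner n x i j = x.entry i j := rfl

theorem corner_add (n : ℕ) (x y : FinMat A) : corner n (x + y) = corner n x + corner n y := rfl

theorem corner_smul (n : ℕ) (c : ℂ) (x : FinMat A) : corner n (c • x) = c • corner n x := rfl

theorem corner_star (n : ℕ) (x : FinMat A) : corner n (star x) = star (corner n x) := rfl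

theorem corner_mul {n : ℕ} {x y : FinMat A} (h : Supp n x ∨ Supp n y) :
    corner n (x * y) = corner n x * corner n y := by
  refine CStarMatrix.ext fun i j => ?_
  rw [corner_apply, entry_mul_eq_sum h, CStarMatrix.mul_apply]
  rfl

theorem eq_of_corner_eq {n : ℕ} {x y : FinMat A} (hx : Supp n x) (hy : Supp n y)
    (h : corner n x = corner n y) : x = y := by
  ext i j
  by_cases hij : n ≤ i ∨ n ≤ j
  · rw [hx i j hij, hy i j hij]
  · push Not at hij
    exact congrFun (congrFun h ⟨i, hij.1⟩) ⟨j, hij.2⟩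

theorem exists_supp₂ (x y : FinMat A) : ∃ n, Supp n x ∧ Supp n y :=
  ⟨max x.bound y.bound, x.supp_bound.mono (le_max_left _ _), y.supp_bound.mono (le_max_right _ _)⟩

theorem exists_supp₃ (x y z : FinMat A) : ∃ n, Supp n x ∧ Supp n y ∧ Supp n z := by
  obtain ⟨n, hx, hy⟩ := exists_supp₂ x y
  exact ⟨max n z.bound, hx.mono (le_max_left _ _), hy.mono (le_max_left _ _),
    z.supp_bound.mono (le_max_right _ _)⟩

instance : NonUnitalRing (FinMat A) where
  __ : AddCommGroup (FinMat A) := inferInstance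
  __ : Mul (FinMat A) := inferInstance
  zero_mul x := by ext i j; simp [entry_mul]
  mul_zero x := by ext i j; simp [entry_mul]
  left_distrib x y z := by
    obtain ⟨n, hx, hy, hz⟩ := exists_supp₃ x y z
    refine eq_of_corner_eq (hx.mul (hy.add hz)) ((hx.mul hy).add (hx.mul hz)) ?_
    rw [corner_mul (Or.inl hx), corner_add, corner_add, corner_mul (Or.inl hx),
      corner_mul (Or.inl hx), mul_add]
  right_distrib x y z := by
    obtain ⟨n, hx, hy, hz⟩ := exists_supp₃ x y z
    refine eq_of_corner_eq ((hx.add hy).mul hz) ((hx.mul hz).add (hy.mul hz)) ?_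
    rw [corner_mul (Or.inr hz), corner_add, corner_add, corner_mul (Or.inr hz),
      corner_mul (Or.inr hz), add_mul]
  mul_assoc x y z := by
    obtain ⟨n, hx, hy, hz⟩ := exists_supp₃ x y z
    refine eq_of_corner_eq ((hx.mul hy).mul hz) (hx.mul (hy.mul hz)) ?_
    rw [corner_mul (Or.inr hz), corner_mul (Or.inl hx), corner_mul (Or.inl hx),
      corner_mul (Or.inl hy), mul_assoc]

instance : StarRing (FinMat A) where
  star_involutive x := by ext i j; simp
  star_add x y := by ext i j; simp
  star_mul x y := by
    obtain ⟨n, hx, hy⟩ := exists_supp₂ x y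
    refine eq_of_corner_eq (hx.mul hy).star (hy.star.mul hx.star) ?_
    rw [corner_star, corner_mul (Or.inl hx), corner_mul (Or.inl hy.star), corner_star, corner_star,
      star_mul]

instance : StarModule ℂ (FinMat A) where
  star_smul c x := by ext i j; simp

instance : IsScalarTower ℂ (FinMat A) (FinMat A) where
  smul_assoc c x y := by
    obtain ⟨n, hx, hy⟩ := exists_supp₂ x y
    change (c • x) * y = c • (x * y)
    refine eq_of_corner_eq ((hx.smul c).mul hy) ((hx.mul hy).smul c) ?_
    rw [corner_mul (Or.inr hy), corner_smul, corner_smul, corner_mul (Or.inr hy)]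
    exact Matrix.smul_mul c (corner n x : Matrix (Fin n) (Fin n) A) (corner n y)

instance : SMulCommClass ℂ (FinMat A) (FinMat A) where
  smul_comm c x y := by
    obtain ⟨n, hx, hy⟩ := exists_supp₂ x y
    change c • (x * y) = x * (c • y)
    refine eq_of_corner_eq ((hx.mul hy).smul c) (hx.mul (hy.smul c)) ?_
    rw [corner_mul (Or.inl hx), corner_smul, corner_smul, corner_mul (Or.inl hx)]
    exact (Matrix.mul_smul (corner n x : Matrix (Fin n) (Fin n) A) c (corner n y)).symm

end Algebra

section Norm

variable {A : Type*} [NonUnitalCStarAlgebra A] [PartialOrder A] [StarOrderedRing A]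

/-- A matrix in `M_n(A)`, extended by zero to a matrix in `M_m(A)`. -/
def padFun {n : ℕ} (m : ℕ) (x : CStarMatrix (Fin n) (Fin n) A) : CStarMatrix (Fin m) (Fin m) A :=
  CStarMatrix.ofMatrix (Matrix.of fun i j =>
    if hij : (i : ℕ) < n ∧ (j : ℕ) < n then x ⟨i, hij.1⟩ ⟨j, hij.2⟩ else 0)

theorem padFun_pos {n m : ℕ} (x : CStarMatrix (Fin n) (Fin n) A) {i j : Fin m}
    (hi : (i : ℕ) < n) (hj : (j : ℕ) < n) : padFun m x i j = x ⟨i, hi⟩ ⟨j, hj⟩ :=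
  dif_pos (c := (i : ℕ) < n ∧ (j : ℕ) < n) ⟨hi, hj⟩

theorem padFun_neg {n m : ℕ} (x : CStarMatrix (Fin n) (Fin n) A) {i j : Fin m}
    (h : ¬((i : ℕ) < n ∧ (j : ℕ) < n)) : padFun m x i j = 0 :=
  dif_neg h

/-- The inclusion of `M_n(A)` into `M_m(A)` as the upper left corner. -/
def pad {n m : ℕ} (h : n ≤ m) :
    CStarMatrix (Fin n) (Fin n) A →⋆ₙₐ[ℂ] CStarMatrix (Fin m) (Fin m) A where
  toFun x := padFun m x
  map_smul' c x := by
    refine CStarMatrix.ext fun i j => ?_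
    rw [CStarMatrix.smul_apply]
    by_cases hij : (i : ℕ) < n ∧ (j : ℕ) < n
    · rw [padFun_pos _ hij.1 hij.2, padFun_pos _ hij.1 hij.2, CStarMatrix.smul_apply]
      rfl
    · rw [padFun_neg _ hij, padFun_neg _ hij, smul_zero]
  map_zero' := by
    refine CStarMatrix.ext fun i j => ?_
    by_cases hij : (i : ℕ) < n ∧ (j : ℕ) < n
    · rw [padFun_pos _ hij.1 hij.2, CStarMatrix.zero_apply, CStarMatrix.zero_apply]
    · rw [padFun_neg _ hij, CStarMatrix.zero_apply]
  map_add' x y := by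
    refine CStarMatrix.ext fun i j => ?_
    rw [CStarMatrix.add_apply]
    by_cases hij : (i : ℕ) < n ∧ (j : ℕ) < n
    · simp only [padFun_pos _ hij.1 hij.2, CStarMatrix.add_apply]
    · simp only [padFun_neg _ hij, add_zero]
  map_mul' x y := by
    refine CStarMatrix.ext fun i j => ?_
    rw [CStarMatrix.mul_apply,
      ← Finset.sum_subset (Finset.subset_univ (Finset.univ.map (Fin.castLEEmb h)))]
    · rw [Finset.sum_map]
      by_cases hij : (i : ℕ) < n ∧ (j : ℕ) < n
      · rw [padFun_pos _ hij.1 hij.2, CStarMatrix.mul_apply]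
        refine Finset.sum_congr rfl fun k _ => ?_
        rw [padFun_pos (j := Fin.castLEEmb h k) x hij.1 k.2,
          padFun_pos (i := Fin.castLEEmb h k) y k.2 hij.2]
        rfl
      · rw [padFun_neg _ hij]
        symm
        refine Finset.sum_eq_zero fun k _ => ?_
        rw [not_and_or] at hij
        rcases hij with h' | h'
        · rw [padFun_neg x fun hh => h' hh.1, zero_mul]
        · rw [padFun_neg y fun hh => h' hh.2, mul_zero]
    · intro k _ hk
      have hk' : ¬ (k : ℕ) < n := fun hkn => hk (by
        rw [Finset.mem_map]
        exact ⟨⟨k, hkn⟩, Finset.mem_univ _, rfl⟩)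
      rw [padFun_neg x fun hh => hk' hh.2, zero_mul]
  map_star' x := by
    refine CStarMatrix.ext fun i j => ?_
    rw [CStarMatrix.star_apply]
    by_cases hij : (i : ℕ) < n ∧ (j : ℕ) < n
    · rw [padFun_pos _ hij.1 hij.2, padFun_pos _ hij.2 hij.1, CStarMatrix.star_apply]
    · rw [padFun_neg _ hij, padFun_neg _ fun hh => hij hh.symm, star_zero]

theorem pad_injective {n m : ℕ} (h : n ≤ m) : Function.Injective (pad (A := A) h) := by
  intro x y hxy
  refine CStarMatrix.ext fun i j => ?_
  have := congrFun (congrFun hxy (Fin.castLE h i)) (Fin.castLE h j)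
  change padFun m x _ _ = padFun m y _ _ at this
  rwa [padFun_pos (i := Fin.castLE h i) (j := Fin.castLE h j) x i.2 j.2,
    padFun_pos (i := Fin.castLE h i) (j := Fin.castLE h j) y i.2 j.2] at this

theorem pad_corner {n m : ℕ} (h : n ≤ m) {x : FinMat A} (hx : Supp n x) :
    pad h (corner n x) = corner m x := by
  refine CStarMatrix.ext fun i j => ?_
  change (if hij : (i : ℕ) < n ∧ (j : ℕ) < n then x.entry i j else 0) = x.entry i j
  split_ifs with hij
  · rfl
  · rw [hx i j (by omega)]

/-- The norm of `x ∈ ⋃ₙ M_n(A)` is its C*-norm in any `M_n(A)` that contains it. -/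
instance : Norm (FinMat A) where
  norm x := ‖corner x.bound x‖

theorem norm_eq_of_le {n m : ℕ} (h : n ≤ m) {x : FinMat A} (hx : Supp n x) :
    ‖corner n x‖ = ‖corner m x‖ := by
  rw [← pad_corner h hx, NonUnitalStarAlgHom.norm_map (pad (A := A) h) (pad_injective h)]

theorem norm_eq {n : ℕ} {x : FinMat A} (hx : Supp n x) : ‖x‖ = ‖corner n x‖ := by
  change ‖corner x.bound x‖ = _
  rw [norm_eq_of_le (le_max_left x.bound n) x.supp_bound, norm_eq_of_le (le_max_right x.bound n) hx]

theorem normedSpaceCore : NormedSpace.Core ℂ (FinMat A) where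
  norm_nonneg x := norm_nonneg (corner x.bound x)
  norm_smul c x := by
    rw [norm_eq (x.supp_bound.smul c), norm_eq x.supp_bound, corner_smul, norm_smul]
  norm_triangle x y := by
    obtain ⟨n, hx, hy⟩ := exists_supp₂ x y
    rw [norm_eq (hx.add hy), norm_eq hx, norm_eq hy, corner_add]
    exact norm_add_le _ _
  norm_eq_zero_iff x := by
    rw [norm_eq x.supp_bound, norm_eq_zero]
    constructor
    · intro h
      exact eq_of_corner_eq x.supp_bound (fun i j _ => rfl) (h.trans rfl)
    · intro h
      rw [h]
      rfl

instance : NormedAddCommGroup (FinMat A) := .ofCore normedSpaceCore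

instance : NormedSpace ℂ (FinMat A) := .ofCore normedSpaceCore

instance : NonUnitalNormedRing (FinMat A) where
  __ : NonUnitalRing (FinMat A) := inferInstance
  __ : NormedAddCommGroup (FinMat A) := inferInstance
  norm_mul_le x y := by
    obtain ⟨n, hx, hy⟩ := exists_supp₂ x y
    rw [norm_eq (hx.mul hy), norm_eq hx, norm_eq hy, corner_mul (Or.inl hx)]
    exact norm_mul_le _ _

instance : CStarRing (FinMat A) where
  norm_mul_self_le x := by
    rw [norm_eq (x.supp_bound.star.mul x.supp_bound), norm_eq x.supp_bound,
      corner_mul (Or.inr x.supp_bound), corner_star, CStarRing.norm_star_mul_self]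

theorem norm_entry_le (x : FinMat A) (i j : ℕ) : ‖x.entry i j‖ ≤ ‖x‖ := by
  have hx : Supp (max x.bound (max i j + 1)) x := x.supp_bound.mono (le_max_left _ _)
  rw [norm_eq hx]
  exact CStarMatrix.norm_entry_le_norm (M := corner (max x.bound (max i j + 1)) x)
    (i := ⟨i, by omega⟩) (j := ⟨j, by omega⟩)

/-- The entries, as continuous linear maps. -/
def entryL (i j : ℕ) : FinMat A →L[ℂ] A :=
  LinearMap.mkContinuous
    { toFun := fun x => x.entry i j, map_add' := fun _ _ => rfl, map_smul' := fun _ _ => rfl } 1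
    fun x => (x.norm_entry_le i j).trans_eq (one_mul _).symm

end Norm

end FinMat

/-! ### The C*-algebra `A ⊗ K(H)` -/

/-- The stabilization `A ⊗ K(H)`, with `H = ℓ²(ℕ)`: the completion of `⋃ₙ M_n(A)` in its unique
C*-norm. -/
def Stabilization (A : Type*) [NonUnitalCStarAlgebra A] [PartialOrder A] [StarOrderedRing A] :
    Type _ :=
  UniformSpace.Completion (FinMat A)

namespace Stabilization

open UniformSpace UniformSpace.Completion

variable {A : Type*} [NonUnitalCStarAlgebra A] [PartialOrder A] [StarOrderedRing A]

instance : NormedAddCommGroup (Stabilization A) :=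
  inferInstanceAs (NormedAddCommGroup (Completion (FinMat A)))
instance : NormedSpace ℂ (Stabilization A) :=
  inferInstanceAs (NormedSpace ℂ (Completion (FinMat A)))
instance : CompleteSpace (Stabilization A) :=
  inferInstanceAs (CompleteSpace (Completion (FinMat A)))

/-- The inclusion of `⋃ₙ M_n(A)` into `A ⊗ K(H)`. -/
def ofFinMat : FinMat A →ₗᵢ[ℂ] Stabilization A := toComplₗᵢ

theorem denseRange_ofFinMat : DenseRange (ofFinMat (A := A)) := denseRange_coe

theorem isDenseInducing_ofFinMat : IsDenseInducing (ofFinMat (A := A)) := isDenseInducing_coe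

/-- Multiplication: the continuous extension of the multiplication of `⋃ₙ M_n(A)`. -/
instance : Mul (Stabilization A) where
  mul := Function.curry ((isDenseInducing_ofFinMat.prodMap isDenseInducing_ofFinMat).extend
    (fun p : FinMat A × FinMat A => ofFinMat (p.1 * p.2)))

/-- The involution: the continuous extension of the involution of `⋃ₙ M_n(A)`. -/
instance : Star (Stabilization A) where
  star := isDenseInducing_ofFinMat.extend (fun x : FinMat A => ofFinMat (star x))

theorem ofFinMat_mul (x y : FinMat A) : ofFinMat (x * y) = ofFinMat x * ofFinMat y :=
  ((isDenseInducing_ofFinMat.prodMap isDenseInducing_ofFinMat).extend_eq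
    (ofFinMat.continuous.comp continuous_mul) (x, y)).symm

theorem ofFinMat_star (x : FinMat A) : ofFinMat (star x) = star (ofFinMat x) :=
  (isDenseInducing_ofFinMat.extend_eq (ofFinMat.continuous.comp continuous_star) x).symm

instance : ContinuousMul (Stabilization A) where
  continuous_mul := by
    let m : FinMat A →+ FinMat A →+ Stabilization A :=
      (AddMonoidHom.mul : FinMat A →+ FinMat A →+ FinMat A).compr₂
        (ofFinMat (A := A)).toLinearMap.toAddMonoidHom
    have hm : Continuous fun p : FinMat A × FinMat A => m p.1 p.2 :=
      ofFinMat.continuous.comp continuous_mul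
    have di : IsDenseInducing
        ((ofFinMat (A := A)).toLinearMap.toAddMonoidHom : FinMat A → Stabilization A) :=
      isDenseInducing_ofFinMat
    exact di.extend_Z_bilin di hm

instance : ContinuousStar (Stabilization A) where
  continuous_star := by
    refine isDenseInducing_ofFinMat.continuous_extend fun b => ?_
    have hu : UniformContinuous fun x : FinMat A => ofFinMat (star x) :=
      ofFinMat.isometry.uniformContinuous.comp (starₗᵢ ℂ : FinMat A ≃ₗᵢ⋆[ℂ] FinMat A).isometry.uniformContinuous
    exact uniformly_extend_exists (isUniformInducing_coe _) denseRange_coe hu b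

@[elab_as_elim]
theorem ind₁ {p : Stabilization A → Prop} (x : Stabilization A) (hp : IsClosed {x | p x})
    (h : ∀ x, p (ofFinMat x)) : p x := Completion.induction_on x hp h

@[elab_as_elim]
theorem ind₂ {p : Stabilization A → Stabilization A → Prop} (x y : Stabilization A)
    (hp : IsClosed {x : Stabilization A × Stabilization A | p x.1 x.2})
    (h : ∀ x y, p (ofFinMat x) (ofFinMat y)) : p x y := Completion.induction_on₂ x y hp h

@[elab_as_elim]
theorem ind₃ {p : Stabilization A → Stabilization A → Stabilization A → Prop}
    (x y z : Stabilization A)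
    (hp : IsClosed {x : Stabilization A × Stabilization A × Stabilization A | p x.1 x.2.1 x.2.2})
    (h : ∀ x y z, p (ofFinMat x) (ofFinMat y) (ofFinMat z)) : p x y z :=
  Completion.induction_on₃ x y z hp h

instance : NonUnitalNormedRing (Stabilization A) where
  __ : NormedAddCommGroup (Stabilization A) := inferInstance
  __ : Mul (Stabilization A) := inferInstance
  zero_mul x := by
    refine ind₁ x (isClosed_eq (by fun_prop) (by fun_prop)) fun x => ?_
    rw [← map_zero ofFinMat, ← ofFinMat_mul, zero_mul]
  mul_zero x := by
    refine ind₁ x (isClosed_eq (by fun_prop) (by fun_prop)) fun x => ?_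
    rw [← map_zero ofFinMat, ← ofFinMat_mul, mul_zero]
  left_distrib x y z := by
    refine ind₃ x y z (isClosed_eq (by fun_prop) (by fun_prop)) fun x y z => ?_
    simp only [← map_add, ← ofFinMat_mul, mul_add]
  right_distrib x y z := by
    refine ind₃ x y z (isClosed_eq (by fun_prop) (by fun_prop)) fun x y z => ?_
    simp only [← map_add, ← ofFinMat_mul, add_mul]
  mul_assoc x y z := by
    refine ind₃ x y z (isClosed_eq (by fun_prop) (by fun_prop)) fun x y z => ?_
    simp only [← ofFinMat_mul, mul_assoc]
  norm_mul_le x y := by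
    refine ind₂ x y (isClosed_le (by fun_prop) (by fun_prop)) fun x y => ?_
    simp only [← ofFinMat_mul, LinearIsometry.norm_map]
    exact norm_mul_le x y

instance : StarRing (Stabilization A) where
  star_involutive x := by
    refine ind₁ x (isClosed_eq (by fun_prop) (by fun_prop)) fun x => ?_
    simp only [← ofFinMat_star, star_star]
  star_add x y := by
    refine ind₂ x y (isClosed_eq (by fun_prop) (by fun_prop)) fun x y => ?_
    simp only [← ofFinMat_star, ← map_add, star_add]
  star_mul x y := by
    refine ind₂ x y (isClosed_eq (by fun_prop) (by fun_prop)) fun x y => ?_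
    simp only [← ofFinMat_star, ← ofFinMat_mul, star_mul]

instance : CStarRing (Stabilization A) where
  norm_mul_self_le x := by
    refine ind₁ x (isClosed_le (by fun_prop) (by fun_prop)) fun x => ?_
    simp only [← ofFinMat_star, ← ofFinMat_mul, LinearIsometry.norm_map]
    exact CStarRing.norm_mul_self_le x

theorem smul_mul_aux (c : ℂ) (x y : Stabilization A) : (c • x) * y = c • (x * y) := by
  refine ind₂ x y (isClosed_eq ((continuous_fst.const_smul c).mul continuous_snd)
    ((continuous_fst.mul continuous_snd).const_smul c)) fun x y => ?_
  rw [← map_smul, ← ofFinMat_mul, ← ofFinMat_mul, ← map_smul, smul_mul_assoc]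

theorem mul_smul_aux (c : ℂ) (x y : Stabilization A) : x * (c • y) = c • (x * y) := by
  refine ind₂ x y (isClosed_eq (continuous_fst.mul (continuous_snd.const_smul c))
    ((continuous_fst.mul continuous_snd).const_smul c)) fun x y => ?_
  rw [← map_smul, ← ofFinMat_mul, ← ofFinMat_mul, ← map_smul, mul_smul_comm]

theorem star_smul_aux (c : ℂ) (x : Stabilization A) : star (c • x) = star c • star x := by
  refine ind₁ x (isClosed_eq (continuous_id.const_smul c).star
    (continuous_id.star.const_smul (star c))) fun x => ?_
  rw [← map_smul, ← ofFinMat_star, ← ofFinMat_star, ← map_smul, star_smul]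

instance : NonUnitalCStarAlgebra (Stabilization A) where
  smul_assoc := smul_mul_aux
  smul_comm c x y := (mul_smul_aux c x y).symm
  star_smul := star_smul_aux

/-- The usual order of the C*-algebra `A ⊗ K(H)`. -/
instance : PartialOrder (Stabilization A) := CStarAlgebra.spectralOrder _
instance : StarOrderedRing (Stabilization A) := CStarAlgebra.spectralOrderedRing _

/-- The matrix entries of elements of `A ⊗ K(H)`: the continuous extensions of the matrix entries
of elements of `⋃ₙ M_n(A)`. -/
def entry (i j : ℕ) : Stabilization A →L[ℂ] A :=
  (FinMat.entryL i j).extend (ofFinMat (A := A)).toContinuousLinearMap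

theorem entry_ofFinMat (i j : ℕ) (x : FinMat A) : entry i j (ofFinMat x) = x.entry i j :=
  ContinuousLinearMap.extend_eq (e := (ofFinMat (A := A)).toContinuousLinearMap)
    (FinMat.entryL i j) denseRange_ofFinMat ofFinMat.isometry.isUniformInducing x

/-- The compression `(1 ⊗ e) x (1 ⊗ e) ∈ M_n(A)` of `x ∈ A ⊗ K(H)`, where `e` is the projection
onto the span of the first `n` basis vectors of `H`. -/
def compress (n : ℕ) (x : Stabilization A) : CStarMatrix (Fin n) (Fin n) A :=
  CStarMatrix.ofMatrix fun i j => entry i j x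

theorem entry_diag_nonneg (i : ℕ) {x : Stabilization A} (hx : 0 ≤ x) : 0 ≤ entry i i x := by
  obtain ⟨y, rfl⟩ := CStarAlgebra.nonneg_iff_eq_star_mul_self.mp hx
  refine ind₁ y (isClosed_le (by fun_prop) (by fun_prop)) fun y => ?_
  rw [← ofFinMat_star, ← ofFinMat_mul, entry_ofFinMat,
    FinMat.entry_mul_eq_sum (Or.inr y.supp_bound)]
  exact Finset.sum_nonneg fun k _ => star_mul_self_nonneg _

end Stabilization

/-! ### Traces -/

section Trace

variable {A : Type*} [CStarAlgebra A] [PartialOrder A] [StarOrderedRing A]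

/-- A unital C*-algebra is simple if it has no closed two-sided ideals but `0` and itself. -/
def IsSimpleCStarAlgebra (A : Type*) [CStarAlgebra A] : Prop :=
  Nontrivial A ∧ ∀ I : TwoSidedIdeal A, IsClosed (I : Set A) → I = ⊥ ∨ I = ⊤

/-- Normalized traces: positive linear functionals `τ` with `τ(1) = 1` and `τ(ab) = τ(ba)`. -/
def IsNormalizedTrace (τ : A →ₚ[ℂ] ℂ) : Prop :=
  τ 1 = 1 ∧ ∀ a b : A, τ (a * b) = τ (b * a)

/-- The trace `τ ⊗ Tr` on `M_n(A)`, with `Tr` the unnormalized trace. -/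
def matrixTrace (τ : A →ₚ[ℂ] ℂ) {n : ℕ} (x : CStarMatrix (Fin n) (Fin n) A) : ℂ :=
  ∑ i, τ (x i i)

/-- The corner `p M p` of a *-algebra `M` at a projection `p`. -/
def projCorner {M : Type*} [NonUnitalRing M] [StarRing M] [Module ℂ M] [IsScalarTower ℂ M M]
    [SMulCommClass ℂ M M] {p : M} (hp : IsStarProjection p) : NonUnitalStarSubalgebra ℂ M where
  carrier := {x | ∃ y, x = p * y * p}
  zero_mem' := ⟨0, by simp⟩
  add_mem' := by
    rintro _ _ ⟨x, rfl⟩ ⟨y, rfl⟩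
    exact ⟨x + y, by rw [mul_add, add_mul]⟩
  mul_mem' := by
    rintro _ _ ⟨x, rfl⟩ ⟨y, rfl⟩
    exact ⟨x * p * (p * y), by simp only [mul_assoc]⟩
  smul_mem' := by
    rintro c _ ⟨x, rfl⟩
    exact ⟨c • x, by rw [mul_smul_comm, smul_mul_assoc]⟩
  star_mem' := by
    rintro _ ⟨x, rfl⟩
    exact ⟨star x, by simp only [star_mul, hp.isSelfAdjoint.star_eq, mul_assoc]⟩

/-- The fundamental group `F(A)`: the numbers `τ ⊗ Tr(p) > 0`, where `p` is a projection in some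
`M_n(A)` with `p M_n(A) p ≅ A`. -/
def fundamentalGroup (τ : A →ₚ[ℂ] ℂ) : Set ℝ :=
  {t | 0 < t ∧ ∃ (n : ℕ) (p : CStarMatrix (Fin n) (Fin n) A) (hp : IsStarProjection p),
    Nonempty (projCorner hp ≃⋆ₐ[ℂ] A) ∧ matrixTrace τ p = t}

/-- The extended trace `τ̂` on `(A ⊗ K(H))₊`: the supremum of the numbers `τ ⊗ Tr(e x e)`, where
`e` is the unit of some `M_n(A)`. It is the lower semicontinuous trace on `A ⊗ K(H)` that agrees
with `τ ⊗ Tr` on the positive elements of every `M_n(A)`. -/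
def tauHat (τ : A →ₚ[ℂ] ℂ) (x : Stabilization A) : ℝ≥0∞ :=
  ⨆ n : ℕ, ENNReal.ofReal (matrixTrace τ (x.compress n)).re

/-- The cone of the positive `x` with `τ̂(x) < ∞`. -/
def finiteTracePos (τ : A →ₚ[ℂ] ℂ) : Set (Stabilization A) :=
  {x | 0 ≤ x ∧ tauHat τ x < ∞}

/-- The domain of `τ̂`: the linear span of the cone of the positive `x` with `τ̂(x) < ∞`. -/
def traceDomain (τ : A →ₚ[ℂ] ℂ) : Submodule ℂ (Stabilization A) :=
  Submodule.span ℂ (finiteTracePos τ)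

theorem matrixTrace_compress (τ : A →ₚ[ℂ] ℂ) (x : Stabilization A) (n : ℕ) :
    matrixTrace τ (x.compress n) = ∑ i ∈ Finset.range n, τ (Stabilization.entry i i x) :=
  Fin.sum_univ_eq_sum_range (fun i => τ (Stabilization.entry i i x)) n

theorem trace_entry_eq_ofReal (τ : A →ₚ[ℂ] ℂ) {x : Stabilization A} (hx : 0 ≤ x) (i : ℕ) :
    0 ≤ (τ (Stabilization.entry i i x)).re ∧
      τ (Stabilization.entry i i x) = ((τ (Stabilization.entry i i x)).re : ℂ) := by
  have h := map_nonneg τ (Stabilization.entry_diag_nonneg i hx)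
  rw [Complex.le_def] at h
  exact ⟨h.1, Complex.ext rfl (by simpa using h.2.symm)⟩

theorem tauHat_eq_tsum (τ : A →ₚ[ℂ] ℂ) {x : Stabilization A} (hx : 0 ≤ x) :
    tauHat τ x = ∑' i, ENNReal.ofReal (τ (Stabilization.entry i i x)).re := by
  rw [ENNReal.tsum_eq_iSup_nat]
  refine iSup_congr fun n => ?_
  rw [matrixTrace_compress, Complex.re_sum,
    ENNReal.ofReal_sum_of_nonneg fun i _ => (trace_entry_eq_ofReal τ hx i).1]

theorem hasSum_of_mem_finiteTracePos (τ : A →ₚ[ℂ] ℂ) {x : Stabilization A}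
    (hx : x ∈ finiteTracePos τ) :
    HasSum (fun i => τ (Stabilization.entry i i x)) ((tauHat τ x).toReal : ℂ) := by
  have h0 := fun i => (trace_entry_eq_ofReal τ hx.1 i).1
  have hfin : ∑' i, ENNReal.ofReal (τ (Stabilization.entry i i x)).re ≠ ∞ := by
    rw [← tauHat_eq_tsum τ hx.1]
    exact hx.2.ne
  have hs := ENNReal.hasSum_toReal hfin
  rw [← ENNReal.tsum_toReal_eq (ENNReal.ne_top_of_tsum_ne_top hfin), ← tauHat_eq_tsum τ hx.1] at hs
  simp only [ENNReal.toReal_ofReal (h0 _)] at hs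
  have := Complex.hasSum_ofReal.mpr hs
  convert this using 2 with i
  exact (trace_entry_eq_ofReal τ hx.1 i).2

theorem summable_of_mem_traceDomain (τ : A →ₚ[ℂ] ℂ) {x : Stabilization A}
    (hx : x ∈ traceDomain τ) : Summable fun i => τ (Stabilization.entry i i x) := by
  induction hx using Submodule.span_induction with
  | mem x hx => exact (hasSum_of_mem_finiteTracePos τ hx).summable
  | zero => simp
  | add x y _ _ hx hy => simpa using hx.add hy
  | smul c x _ hx => simpa using hx.mul_left c

/-- `τ̂` as a linear functional on its domain. It is the linear extension of the restriction of
`tauHat τ` to the positive elements with `τ̂(x) < ∞`; see `tauHatLin_eq`. -/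
def tauHatLin (τ : A →ₚ[ℂ] ℂ) : traceDomain τ →ₗ[ℂ] ℂ where
  toFun x := ∑' i, τ (Stabilization.entry i i (x : Stabilization A))
  map_add' x y := by
    simpa using
      (summable_of_mem_traceDomain τ x.2).tsum_add (summable_of_mem_traceDomain τ y.2)
  map_smul' c x := by
    simp [tsum_mul_left]

theorem tauHatLin_eq (τ : A →ₚ[ℂ] ℂ) {x : Stabilization A} (hx : x ∈ finiteTracePos τ) :
    tauHatLin τ ⟨x, Submodule.subset_span hx⟩ = ((tauHat τ x).toReal : ℂ) :=
  (hasSum_of_mem_finiteTracePos τ hx).tsum_eq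

/-- The set `𝔖(A)` of trace-scaling constants: the `t > 0` for which there is an automorphism `α`
of `A ⊗ K(H)` with `τ̂(α(x)) = t τ̂(x)` for all `x` in the domain of `τ̂`. -/
def traceScalingGroup (τ : A →ₚ[ℂ] ℂ) : Set ℝ :=
  {t | 0 < t ∧ ∃ α : Stabilization A ≃⋆ₐ[ℂ] Stabilization A, ∀ x : traceDomain τ,
    ∃ h : α x ∈ traceDomain τ, tauHatLin τ ⟨α x, h⟩ = t * tauHatLin τ x}

end Trace

end

/-! The idea: both groups describe how `B = A ⊗ K(H)` can be identified with itself. An automorphism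
`α` of `B` moves the projection `e`, the unit of `M_1(A)`, to a projection whose corner is again a
copy of `A`, and it scales the trace by the trace of `α(e)`.

From scaling constants to projections (`traceScalingGroup_subset_fundamentalGroup`): `α(e)` need not
lie in any `M_n(A)`, but the units `1_n` form an approximate unit of `B`, so for large `n` the
element `α(e) 1_n α(e)` is close to the unit of the corner at `α(e)`. Its inverse square root yields
a partial isometry from `α(e)` to a projection in `M_n(A)`; the trace and the isomorphism class of
the corner are unchanged.

From projections to scaling constants (`fundamentalGroup_subset_traceScalingGroup`): let `p` be a
nonzero projection in `M_n(A)` and `X` its range in the left module `A^∞` of finitely supported row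
vectors, with the `A`-valued form `∑ x_i y_i*`. Then `X` is a summand of `A^∞`. Since `A` is simple,
the values of the form on `X` generate `A` as a closed ideal; by polarization and an inverse square
root, `X^∞` contains a vector of square one (`HermModule.exists_form_eq_one`), so `A` is a summand
of `X^∞`. By a swindle, `A^∞` and `X^∞` are isometric
(`HermModule.isometric_finsupp_of_summands`). The components of such an isometry are partial
isometries `w j` in `⋃ₙ M_n(A)` whose supports are orthogonal and exhaust the space, each with range
projection `p` (`FinMat.exists_partialIsometries`). If `p M_n(A) p ≅ A`, the entries `w i b (w j)*`
then define an automorphism of `⋃ₙ M_n(A)` (`FinMat.exists_starAlgEquiv`), which extends to `B`. It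
scales the trace because `τ ⊗ Tr` restricts to a multiple of the unique trace on
`p M_n(A) p ≅ A`.

The group structure comes from the reformulation `mem_traceScalingGroup_iff`: an automorphism scales
`τ̂` on its domain exactly if it scales it on all positive elements, with values in `[0, ∞]`. This
uses that `τ̂` is tracial, monotone and a supremum over compressions (`mul_tauHat_le`). -/

noncomputable section

open Filter Topology

/-! ### The inclusions of `M_n(A)` and of `A` into the finitely supported matrices -/

namespace FinMat

section Algebra

variable {A : Type*} [Ring A] [StarRing A] [Algebra ℂ A] [StarModule ℂ A]

/-- The finitely supported matrix with given entries, which vanish outside the upper left `n × n`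
corner. -/
def mk (n : ℕ) (f : ℕ → ℕ → A) (h : ∀ i j, n ≤ i ∨ n ≤ j → f i j = 0) : FinMat A :=
  (⟨f, n, h⟩ : finMatSubmodule A)

@[simp] theorem entry_mk (n : ℕ) (f : ℕ → ℕ → A) (h) (i j : ℕ) : (mk n f h).entry i j = f i j :=
  rfl

theorem supp_mk (n : ℕ) (f : ℕ → ℕ → A) (h) : Supp n (mk n f h) := h

/-- The inclusion of `M_n(A)` into the finitely supported matrices. -/
def ofCorner (n : ℕ) : CStarMatrix (Fin n) (Fin n) A →⋆ₙₐ[ℂ] FinMat A :=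
  have key : ∀ (x : FinMat A) (y : CStarMatrix (Fin n) (Fin n) A)
      (h : ∀ i j : ℕ, n ≤ i ∨ n ≤ j →
        (if hij : i < n ∧ j < n then y ⟨i, hij.1⟩ ⟨j, hij.2⟩ else 0) = 0),
      Supp n x → corner n x = y →
      mk n (fun i j => if hij : i < n ∧ j < n then y ⟨i, hij.1⟩ ⟨j, hij.2⟩ else 0) h = x := by
    rintro x y h hx rfl
    refine eq_of_corner_eq (supp_mk _ _ _) hx (CStarMatrix.ext fun i j => ?_)
    rw [corner_apply, entry_mk, dif_pos ⟨i.2, j.2⟩]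
  have out : ∀ (y : CStarMatrix (Fin n) (Fin n) A) (i j : ℕ), n ≤ i ∨ n ≤ j →
      (if hij : i < n ∧ j < n then y ⟨i, hij.1⟩ ⟨j, hij.2⟩ else 0) = 0 :=
    fun y i j h => dif_neg (by omega)
  have co : ∀ y : CStarMatrix (Fin n) (Fin n) A, corner n (mk n _ (out y)) = y := fun y =>
    CStarMatrix.ext fun i j => by rw [corner_apply, entry_mk, dif_pos ⟨i.2, j.2⟩]
  { toFun := fun x => mk n _ (out x)
    map_smul' := fun c x => key _ _ _ ((supp_mk _ _ _).smul c) (by rw [corner_smul, co]; rfl)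
    map_zero' := key _ _ _ (fun _ _ _ => rfl) rfl
    map_add' := fun x y => key _ _ _ ((supp_mk _ _ _).add (supp_mk _ _ _))
      (by rw [corner_add, co, co])
    map_mul' := fun x y => key _ _ _ ((supp_mk _ _ _).mul (supp_mk _ _ _))
      (by rw [corner_mul (Or.inl (supp_mk _ _ _)), co, co])
    map_star' := fun x => key _ _ _ (supp_mk _ _ _).star (by rw [corner_star, co]) }

theorem supp_ofCorner (n : ℕ) (x : CStarMatrix (Fin n) (Fin n) A) : Supp n (ofCorner n x) :=
  fun i j h => dif_neg (by omega)

@[simp] theorem entry_ofCorner {n : ℕ} (x : CStarMatrix (Fin n) (Fin n) A) (i j : Fin n) :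
    (ofCorner n x).entry i j = x i j :=
  (dif_pos (⟨i.2, j.2⟩ : (i : ℕ) < n ∧ (j : ℕ) < n))

@[simp] theorem corner_ofCorner (n : ℕ) (x : CStarMatrix (Fin n) (Fin n) A) :
    corner n (ofCorner n x) = x := CStarMatrix.ext fun i j => entry_ofCorner x i j

theorem ofCorner_corner {n : ℕ} {x : FinMat A} (hx : Supp n x) : ofCorner n (corner n x) = x :=
  eq_of_corner_eq (supp_ofCorner _ _) hx (corner_ofCorner _ _)

theorem ofCorner_injective (n : ℕ) : Function.Injective (ofCorner (A := A) n) :=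
  Function.LeftInverse.injective (corner_ofCorner n)

/-- The unit of `M_n(A)`, as a finitely supported matrix. -/
def unit (A : Type*) [Ring A] [StarRing A] [Algebra ℂ A] [StarModule ℂ A] (n : ℕ) : FinMat A :=
  ofCorner n 1

theorem unit_mul_of_supp {n : ℕ} {x : FinMat A} (hx : Supp n x) : unit A n * x = x := by
  rw [unit, ← ofCorner_corner hx, ← map_mul, one_mul]

theorem mul_unit_of_supp {n : ℕ} {x : FinMat A} (hx : Supp n x) : x * unit A n = x := by
  rw [unit, ← ofCorner_corner hx, ← map_mul, mul_one]

theorem star_unit (n : ℕ) : star (unit A n) = unit A n := by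
  rw [unit, ← map_star, star_one]

theorem unit_mul_unit (n : ℕ) : unit A n * unit A n = unit A n := by
  rw [unit, ← map_mul, one_mul]

theorem entry_unit (n i j : ℕ) : (unit A n).entry i j = if i < n ∧ i = j then 1 else 0 := by
  by_cases h : i < n ∧ j < n
  · refine (entry_ofCorner 1 ⟨i, h.1⟩ ⟨j, h.2⟩).trans ?_
    rw [CStarMatrix.one_apply]
    simp [h.1]
  · rw [unit, supp_ofCorner n 1 i j (by omega), if_neg (by omega)]

theorem entry_unit_mul (n : ℕ) (x : FinMat A) (i j : ℕ) :
    (unit A n * x).entry i j = if i < n then x.entry i j else 0 := by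
  rw [entry_mul]
  simp only [entry_unit]
  rw [finsum_eq_single _ i fun k hk => by simp [hk.symm]]
  simp

theorem entry_mul_unit (n : ℕ) (x : FinMat A) (i j : ℕ) :
    (x * unit A n).entry i j = if j < n then x.entry i j else 0 := by
  rw [entry_mul]
  simp only [entry_unit]
  rw [finsum_eq_single _ j fun k hk => by simp [hk]]
  simp

/-- The inclusion of `A = M_1(A)` into the finitely supported matrices as the upper left entry. -/
def topLeft : A →⋆ₙₐ[ℂ] FinMat A :=
  have key : ∀ (x : FinMat A) (a : A) (h : ∀ i j : ℕ, 1 ≤ i ∨ 1 ≤ j →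
        (if i = 0 ∧ j = 0 then a else 0) = 0), Supp 1 x → x.entry 0 0 = a →
      mk 1 (fun i j => if i = 0 ∧ j = 0 then a else 0) h = x := by
    rintro x a h hx rfl
    ext i j
    rw [entry_mk]
    split_ifs with hij
    · rw [hij.1, hij.2]
    · rw [hx i j (by omega)]
  have out : ∀ (a : A) (i j : ℕ), 1 ≤ i ∨ 1 ≤ j → (if i = 0 ∧ j = 0 then a else 0) = 0 :=
    fun a i j h => if_neg (by omega)
  { toFun := fun x => mk 1 _ (out x)
    map_smul' := fun c x => key _ _ _ ((supp_mk _ _ _).smul c) (by simp)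
    map_zero' := key _ _ _ (fun _ _ _ => rfl) rfl
    map_add' := fun x y => key _ _ _ ((supp_mk _ _ _).add (supp_mk _ _ _)) (by simp)
    map_mul' := fun x y => key _ _ _ ((supp_mk _ _ _).mul (supp_mk _ _ _))
      (by rw [entry_mul_eq_sum (n := 1) (Or.inl (supp_mk _ _ _))]; simp)
    map_star' := fun x => key _ _ _ (supp_mk _ _ _).star (by simp) }

theorem entry_topLeft (a : A) (i j : ℕ) :
    (topLeft a).entry i j = if i = 0 ∧ j = 0 then a else 0 := rfl

theorem supp_topLeft (a : A) : Supp 1 (topLeft a) := fun i j h => if_neg (by omega)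

theorem topLeft_injective : Function.Injective (topLeft (A := A)) := fun a b h => by
  simpa [entry_topLeft] using congrArg (fun x => x.entry 0 0) h

theorem topLeft_one : topLeft (1 : A) = unit A 1 := by
  ext i j
  rw [entry_topLeft, entry_unit]
  congr 1
  apply propext
  omega

theorem topLeft_one_mul_mul (x : FinMat A) :
    topLeft (1 : A) * x * topLeft 1 = topLeft (x.entry 0 0) := by
  ext i j
  rw [topLeft_one, entry_mul_unit, entry_unit_mul, entry_topLeft]
  by_cases hi : i = 0 <;> by_cases hj : j = 0 <;> simp [hi, hj]

/-- Cutting down by the unit of `M_n(A)` is taking the upper left corner. -/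
theorem unit_mul_mul_unit (n : ℕ) (x : FinMat A) :
    unit A n * x * unit A n = ofCorner n (corner n x) := by
  ext i j
  rw [entry_mul_unit, entry_unit_mul]
  by_cases h : i < n ∧ j < n
  · rw [if_pos h.2, if_pos h.1]
    exact (entry_ofCorner (corner n x) ⟨i, h.1⟩ ⟨j, h.2⟩).symm
  · rw [supp_ofCorner n _ i j (by omega)]
    split_ifs <;> first | rfl | omega

end Algebra

end FinMat

/-! ### The approximate unit of `A ⊗ K(H)` formed by the units of the `M_n(A)` -/

/-- A projection in a C*-algebra has norm at most one. -/
theorem norm_le_one_of_star_mul_self {R : Type*} [NonUnitalNormedRing R] [StarRing R] [CStarRing R]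
    {p : R} (hp : star p * p = p) : ‖p‖ ≤ 1 := by
  have h := CStarRing.norm_star_mul_self (x := p)
  rw [hp] at h
  nlinarith [norm_nonneg p]

namespace Stabilization

variable {A : Type*} [CStarAlgebra A] [PartialOrder A] [StarOrderedRing A]

/-- The inclusion of `⋃ₙ M_n(A)` into `A ⊗ K(H)`, as a homomorphism of *-algebras. -/
def ofFinMatHom : FinMat A →⋆ₙₐ[ℂ] Stabilization A where
  toFun := ofFinMat
  map_smul' c x := map_smul ofFinMat c x
  map_zero' := map_zero ofFinMat
  map_add' := map_add ofFinMat
  map_mul' := ofFinMat_mul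
  map_star' := ofFinMat_star

theorem ofFinMat_injective : Function.Injective (ofFinMat (A := A)) :=
  (ofFinMat (A := A)).isometry.injective

/-- The unit of `M_n(A)`, as an element of `A ⊗ K(H)`. -/
def unit (A : Type*) [CStarAlgebra A] [PartialOrder A] [StarOrderedRing A] (n : ℕ) :
    Stabilization A := ofFinMat (FinMat.unit A n)

theorem star_unit (n : ℕ) : star (unit A n) = unit A n := by
  rw [unit, ← ofFinMat_star, FinMat.star_unit]

theorem unit_mul_unit (n : ℕ) : unit A n * unit A n = unit A n := by
  rw [unit, ← ofFinMat_mul, FinMat.unit_mul_unit]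

theorem norm_unit_le (n : ℕ) : ‖unit A n‖ ≤ 1 :=
  norm_le_one_of_star_mul_self (by rw [star_unit, unit_mul_unit])

theorem entry_star (x : Stabilization A) (i j : ℕ) : entry i j (star x) = star (entry j i x) := by
  refine ind₁ x (isClosed_eq (by fun_prop) (by fun_prop)) fun x => ?_
  rw [← ofFinMat_star, entry_ofFinMat, entry_ofFinMat, FinMat.entry_star]

/-- The units of the `M_n(A)` form an approximate unit. -/
theorem tendsto_unit_mul (x : Stabilization A) :
    Tendsto (fun n => unit A n * x) atTop (𝓝 x) := by
  rw [Metric.tendsto_atTop]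
  intro ε hε
  obtain ⟨y, hy⟩ := denseRange_ofFinMat.exists_dist_lt x (half_pos hε)
  refine ⟨y.bound, fun n hn => ?_⟩
  have h1 : unit A n * ofFinMat y = ofFinMat y := by
    rw [unit, ← ofFinMat_mul, FinMat.unit_mul_of_supp (y.supp_bound.mono hn)]
  have h2 : unit A n * x - x = unit A n * (x - ofFinMat y) - (x - ofFinMat y) := by
    rw [mul_sub, h1]; abel
  rw [dist_eq_norm] at hy ⊢
  rw [h2]
  have h3 := norm_sub_le (unit A n * (x - ofFinMat y)) (x - ofFinMat y)
  have h4 := norm_mul_le (unit A n) (x - ofFinMat y)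
  have h5 := mul_le_mul_of_nonneg_right (norm_unit_le (A := A) n) (norm_nonneg (x - ofFinMat y))
  linarith

theorem entry_mul_unit_mul (x y : Stabilization A) (n i j : ℕ) :
    entry i j (x * unit A n * y) = ∑ k ∈ Finset.range n, entry i k x * entry k j y := by
  refine ind₂ x y (isClosed_eq ?_ ?_) fun x y => ?_
  · exact (entry i j).continuous.comp ((continuous_fst.mul continuous_const).mul continuous_snd)
  · exact continuous_finsetSum _ fun k _ =>
      ((entry i k).continuous.comp continuous_fst).mul ((entry k j).continuous.comp continuous_snd)
  simp only [unit, ← ofFinMat_mul, entry_ofFinMat]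
  rw [FinMat.entry_mul]
  simp only [FinMat.entry_mul_unit]
  rw [finsum_eq_sum_of_support_subset (s := Finset.range n)]
  · exact Finset.sum_congr rfl fun k hk => by rw [if_pos (Finset.mem_range.mp hk)]
  · intro k hk
    by_contra hkn
    refine hk ?_
    dsimp only
    rw [if_neg (by simpa using hkn), zero_mul]

/-- The entries of a product: the defining series converges in norm along the initial segments
of `ℕ`. -/
theorem tendsto_sum_entry_mul (x y : Stabilization A) (i j : ℕ) :
    Tendsto (fun n => ∑ k ∈ Finset.range n, entry i k x * entry k j y) atTop
      (𝓝 (entry i j (x * y))) := by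
  have h := ((entry i j).continuous.tendsto _).comp ((tendsto_unit_mul y).const_mul x)
  refine h.congr fun n => ?_
  rw [Function.comp_apply, ← mul_assoc, entry_mul_unit_mul]

/-- The inclusion of `M_n(A)` into `A ⊗ K(H)`. -/
def ofCorner (n : ℕ) : CStarMatrix (Fin n) (Fin n) A →⋆ₙₐ[ℂ] Stabilization A :=
  (ofFinMatHom (A := A)).comp (FinMat.ofCorner (A := A) n)

theorem ofCorner_apply (n : ℕ) (x : CStarMatrix (Fin n) (Fin n) A) :
    ofCorner n x = ofFinMat (FinMat.ofCorner n x) := rfl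

theorem ofCorner_injective (n : ℕ) : Function.Injective (ofCorner (A := A) n) :=
  ofFinMat_injective.comp (FinMat.ofCorner_injective n)

/-- The inclusion of `A` into `A ⊗ K(H)` as the upper left entry. -/
def topLeft : A →⋆ₙₐ[ℂ] Stabilization A :=
  (ofFinMatHom (A := A)).comp (FinMat.topLeft (A := A))

theorem topLeft_apply (a : A) : topLeft a = ofFinMat (FinMat.topLeft a) := rfl

theorem topLeft_injective : Function.Injective (topLeft (A := A)) :=
  ofFinMat_injective.comp FinMat.topLeft_injective

/-- Elements cut down by the unit of `M_n(A)` lie in `M_n(A)`: no completion is needed there. -/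
theorem unit_mul_mul_unit (n : ℕ) (x : Stabilization A) :
    unit A n * x * unit A n = ofCorner n (compress n x) := by
  have hκ : Continuous (ofCorner (A := A) n) := map_continuous _
  have hc : Continuous fun x : Stabilization A => compress n x :=
    (CStarMatrix.ofMatrixL (m := Fin n) (n := Fin n) (A := A)).continuous.comp
      (continuous_pi fun i => continuous_pi fun j => (entry i j).continuous)
  refine ind₁ x (isClosed_eq (by fun_prop) (hκ.comp hc)) fun x => ?_
  have : compress n (ofFinMat x) = FinMat.corner n x :=
    CStarMatrix.ext fun i j => entry_ofFinMat i j x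
  rw [this, unit, ← ofFinMat_mul, ← ofFinMat_mul, FinMat.unit_mul_mul_unit, ofCorner_apply]

theorem topLeft_one_mul_mul (x : Stabilization A) :
    topLeft (1 : A) * x * topLeft (1 : A) = topLeft (entry 0 0 x) := by
  have hκ : Continuous (topLeft (A := A)) := map_continuous _
  refine ind₁ x (isClosed_eq (by fun_prop) (hκ.comp (entry 0 0).continuous)) fun x => ?_
  rw [entry_ofFinMat, topLeft_apply, topLeft_apply, ← ofFinMat_mul, ← ofFinMat_mul,
    FinMat.topLeft_one_mul_mul]

theorem compress_ofCorner (n : ℕ) (x : CStarMatrix (Fin n) (Fin n) A) :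
    compress n (ofCorner n x) = x :=
  CStarMatrix.ext fun i j => (entry_ofFinMat i j _).trans (FinMat.entry_ofCorner x i j)

end Stabilization

/-! ### The trace on the finitely supported matrices and its extension -/

section Traces

variable {A : Type*} [CStarAlgebra A] [PartialOrder A] [StarOrderedRing A]

/-- The trace `τ ⊗ Tr` on the finitely supported matrices. -/
def FinMat.tr (τ : A →ₚ[ℂ] ℂ) : FinMat A →ₗ[ℂ] ℂ where
  toFun x := ∑ᶠ i, τ (x.entry i i)
  map_add' x y := by
    have h : ∀ z : FinMat A, (Function.support fun i => τ (z.entry i i)).Finite := fun z =>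
      (Set.finite_lt_nat z.bound).subset fun i hi => by
        by_contra hn
        exact hi (by simp [z.supp_bound i i (Or.inl (not_lt.mp hn))])
    rw [← finsum_add_distrib (h x) (h y)]
    simp
  map_smul' c x := by simp [-smul_eq_mul, smul_finsum]

theorem FinMat.tr_eq_sum (τ : A →ₚ[ℂ] ℂ) {n : ℕ} {x : FinMat A} (hx : Supp n x) :
    FinMat.tr τ x = ∑ i ∈ Finset.range n, τ (x.entry i i) := by
  refine finsum_eq_sum_of_support_subset _ fun i hi => ?_
  by_contra hn
  exact hi (by simp [hx i i (Or.inl (by simpa using hn))])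

theorem FinMat.tr_mul_comm {τ : A →ₚ[ℂ] ℂ} (hτ : ∀ a b : A, τ (a * b) = τ (b * a))
    (x y : FinMat A) : FinMat.tr τ (x * y) = FinMat.tr τ (y * x) := by
  obtain ⟨n, hx, hy⟩ := exists_supp₂ x y
  rw [tr_eq_sum τ (hx.mul hy), tr_eq_sum τ (hy.mul hx)]
  simp only [entry_mul_eq_sum (Or.inl hx), entry_mul_eq_sum (Or.inl hy), map_sum]
  simp only [Finset.sum_range]
  rw [Finset.sum_comm]
  simp only [hτ]

theorem matrixTrace_eq_tr (τ : A →ₚ[ℂ] ℂ) {n : ℕ} (x : CStarMatrix (Fin n) (Fin n) A) :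
    matrixTrace τ x = FinMat.tr τ (FinMat.ofCorner n x) := by
  rw [FinMat.tr_eq_sum τ (FinMat.supp_ofCorner n x), Finset.sum_range]
  simp only [FinMat.entry_ofCorner]
  rfl

variable (τ : A →ₚ[ℂ] ℂ)

theorem tauHat_mono {x y : Stabilization A} (h : x ≤ y) : tauHat τ x ≤ tauHat τ y := by
  refine iSup_mono fun n => ENNReal.ofReal_le_ofReal ?_
  rw [matrixTrace_compress, matrixTrace_compress, Complex.re_sum, Complex.re_sum]
  refine Finset.sum_le_sum fun i _ => ?_
  have := (trace_entry_eq_ofReal τ (sub_nonneg.mpr h) i).1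
  simpa using this

theorem tauHat_ofFinMat {x : FinMat A} (hx : 0 ≤ Stabilization.ofFinMat x) :
    tauHat τ (Stabilization.ofFinMat x) = ENNReal.ofReal (FinMat.tr τ x).re := by
  rw [tauHat_eq_tsum τ hx, FinMat.tr_eq_sum τ x.supp_bound, Complex.re_sum,
    ENNReal.ofReal_sum_of_nonneg, tsum_eq_sum (s := Finset.range x.bound)]
  · simp only [Stabilization.entry_ofFinMat]
  · intro i hi
    rw [Stabilization.entry_ofFinMat, x.supp_bound i i (Or.inl (by simpa using hi))]
    simp
  · intro i _
    have := (trace_entry_eq_ofReal τ hx i).1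
    rwa [Stabilization.entry_ofFinMat] at this

theorem tauHat_ofCorner {n : ℕ} {x : CStarMatrix (Fin n) (Fin n) A}
    (hx : 0 ≤ Stabilization.ofCorner n x) :
    tauHat τ (Stabilization.ofCorner n x) = ENNReal.ofReal (matrixTrace τ x).re := by
  rw [matrixTrace_eq_tr]
  exact tauHat_ofFinMat τ hx

theorem tauHat_unit_mul_mul_unit (n : ℕ) {x : Stabilization A} (hx : 0 ≤ x) :
    tauHat τ (Stabilization.unit A n * x * Stabilization.unit A n) =
      ENNReal.ofReal (matrixTrace τ (x.compress n)).re := by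
  have h := star_left_conjugate_nonneg hx (Stabilization.unit A n)
  rw [Stabilization.star_unit, Stabilization.unit_mul_mul_unit] at h
  rw [Stabilization.unit_mul_mul_unit, tauHat_ofCorner τ h]

/-- The trace of `z z*` is the sum of the traces of the `z_ik z_ik*`. -/
theorem tauHat_mul_star_self (z : Stabilization A) :
    tauHat τ (z * star z) = ∑' (i) (k), ENNReal.ofReal
      (τ (Stabilization.entry i k z * star (Stabilization.entry i k z))).re := by
  rw [tauHat_eq_tsum τ (mul_star_self_nonneg z)]
  refine tsum_congr fun i => tendsto_nhds_unique ?_ (ENNReal.tendsto_nat_tsum _)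
  have hc : Continuous fun a : A => ENNReal.ofReal (τ a).re :=
    ENNReal.continuous_ofReal.comp (Complex.continuous_re.comp (map_continuous τ))
  refine ((hc.tendsto _).comp (Stabilization.tendsto_sum_entry_mul z (star z) i i)).congr
    fun n => ?_
  simp only [Function.comp_apply, map_sum, Complex.re_sum, Stabilization.entry_star]
  refine ENNReal.ofReal_sum_of_nonneg fun k _ => ?_
  have := map_nonneg τ (mul_star_self_nonneg (Stabilization.entry i k z))
  exact (Complex.le_def.mp this).1

/-- The extended trace is tracial. -/
theorem tauHat_star_mul_self {τ : A →ₚ[ℂ] ℂ} (hτ : ∀ a b : A, τ (a * b) = τ (b * a))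
    (z : Stabilization A) : tauHat τ (star z * z) = tauHat τ (z * star z) := by
  have h := tauHat_mul_star_self τ (star z)
  rw [star_star] at h
  rw [h, tauHat_mul_star_self τ z, ENNReal.tsum_comm]
  simp only [Stabilization.entry_star, star_star, hτ]

/-! ### Automorphisms of `A ⊗ K(H)` that scale the trace -/

/-- If an automorphism scales the trace by `c` on the positive elements of `⋃ₙ M_n(A)`, then it
scales it at least by `c` everywhere: with `y = s²`, the trace of `1_n y 1_n` is the trace of
`s 1_n s ≤ y`, and both traces are transported by the automorphism. -/
theorem mul_tauHat_le {τ : A →ₚ[ℂ] ℂ} (hτ : ∀ a b : A, τ (a * b) = τ (b * a))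
    (α : Stabilization A ≃⋆ₐ[ℂ] Stabilization A) (c : ℝ≥0∞)
    (hα : ∀ x : FinMat A, 0 ≤ Stabilization.ofFinMat x →
      tauHat τ (α (Stabilization.ofFinMat x)) = c * tauHat τ (Stabilization.ofFinMat x))
    {y : Stabilization A} (hy : 0 ≤ y) : c * tauHat τ y ≤ tauHat τ (α y) := by
  obtain ⟨s, hs, rfl⟩ : ∃ s : Stabilization A, star s = s ∧ s * s = y :=
    ⟨CFC.sqrt y, (CFC.sqrt_nonneg y).isSelfAdjoint, CFC.sqrt_mul_sqrt_self y hy⟩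
  rw [tauHat, ENNReal.mul_iSup]
  refine iSup_le fun n => ?_
  rw [← tauHat_unit_mul_mul_unit τ n hy]
  set u := Stabilization.unit A n with hu
  have hu1 : star u = u := Stabilization.star_unit n
  have hu2 : u * u = u := Stabilization.unit_mul_unit n
  have hpos : 0 ≤ u * (s * s) * u := by
    have := star_left_conjugate_nonneg hy u
    rwa [hu1] at this
  have h1 : tauHat τ (α (u * (s * s) * u)) = c * tauHat τ (u * (s * s) * u) := by
    rw [hu, Stabilization.unit_mul_mul_unit] at hpos ⊢
    exact hα _ hpos
  have h2 : u * (s * s) * u = (u * s) * star (u * s) := by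
    rw [star_mul, hs, hu1]; simp only [mul_assoc]
  rw [← h1, h2, map_mul, map_star, ← tauHat_star_mul_self hτ, ← map_star, ← map_mul]
  have h3 : star (u * s) * (u * s) ≤ s * s := by
    have h4 : s * s - star (u * s) * (u * s) = star (s - u * s) * (s - u * s) := by
      have h5 : s * (u * (u * s)) = s * (u * s) := by rw [← mul_assoc u, hu2]
      simp only [star_sub, star_mul, hs, hu1, sub_mul, mul_sub, mul_assoc, h5]
      abel
    rw [← sub_nonneg, h4]
    exact star_mul_self_nonneg _
  exact tauHat_mono τ ((OrderHomClass.mono α) h3)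

/-- A positive element of the domain of `τ̂` has finite trace. -/
theorem mem_finiteTracePos_of_mem_traceDomain {x : Stabilization A} (hx : 0 ≤ x)
    (h : x ∈ traceDomain τ) : x ∈ finiteTracePos τ := by
  refine ⟨hx, ?_⟩
  have hs := Complex.reCLM.summable (summable_of_mem_traceDomain τ h)
  rw [tauHat_eq_tsum τ hx,
    ← ENNReal.ofReal_tsum_of_nonneg (fun i => (trace_entry_eq_ofReal τ hx i).1) hs]
  exact ENNReal.ofReal_lt_top

/-- Trace scaling may be tested on positive elements, with values in `[0, ∞]`. -/
theorem mem_traceScalingGroup_iff {τ : A →ₚ[ℂ] ℂ} (hτ : ∀ a b : A, τ (a * b) = τ (b * a))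
    {t : ℝ} : t ∈ traceScalingGroup τ ↔
      0 < t ∧ ∃ α : Stabilization A ≃⋆ₐ[ℂ] Stabilization A,
        ∀ x, 0 ≤ x → tauHat τ (α x) = ENNReal.ofReal t * tauHat τ x := by
  refine and_congr_right fun ht => exists_congr fun α => ⟨fun h => ?_, fun h => ?_⟩
  · have key : ∀ x, x ∈ finiteTracePos τ → tauHat τ (α x) = ENNReal.ofReal t * tauHat τ x := by
      intro x hx
      obtain ⟨hm, he⟩ := h ⟨x, Submodule.subset_span hx⟩
      have hp := mem_finiteTracePos_of_mem_traceDomain τ (map_nonneg α hx.1) hm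
      have e1 := tauHatLin_eq τ hx
      have e2 := tauHatLin_eq τ hp
      rw [he, e1] at e2
      have e3 : t * (tauHat τ x).toReal = (tauHat τ (α x)).toReal := by exact_mod_cast e2
      rw [← ENNReal.ofReal_toReal hp.2.ne, ← e3, ENNReal.ofReal_mul ht.le,
        ENNReal.ofReal_toReal hx.2.ne]
    intro x hx
    by_cases hfin : tauHat τ x < ∞
    · exact key x ⟨hx, hfin⟩
    · have := mul_tauHat_le hτ α (ENNReal.ofReal t) (fun x hx => key _ ⟨hx, by
        rw [tauHat_ofFinMat τ hx]; exact ENNReal.ofReal_lt_top⟩) hx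
      rw [not_lt_top_iff.mp hfin, ENNReal.mul_top (by simpa using ht)] at this ⊢
      exact top_le_iff.mp this
  · rintro ⟨x, hx⟩
    have hfin : ∀ x ∈ finiteTracePos τ, α x ∈ finiteTracePos τ := fun x hx =>
      ⟨map_nonneg α hx.1, by
        rw [h x hx.1]; exact ENNReal.mul_lt_top ENNReal.ofReal_lt_top hx.2⟩
    have hdom : ∀ x ∈ traceDomain τ, α x ∈ traceDomain τ := by
      intro x hx
      induction hx using Submodule.span_induction with
      | mem x hx => exact Submodule.subset_span (hfin x hx)
      | zero => rw [map_zero]; exact zero_mem _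
      | add x y _ _ hx hy => rw [map_add]; exact add_mem hx hy
      | smul c x _ hx => rw [map_smul]; exact Submodule.smul_mem _ c hx
    refine ⟨hdom x hx, ?_⟩
    change ∑' i, τ (Stabilization.entry i i (α x)) = t * ∑' i, τ (Stabilization.entry i i x)
    induction hx using Submodule.span_induction with
    | mem x hx =>
      rw [(hasSum_of_mem_finiteTracePos τ hx).tsum_eq,
        (hasSum_of_mem_finiteTracePos τ (hfin x hx)).tsum_eq, h x hx.1, ENNReal.toReal_mul,
        ENNReal.toReal_ofReal ht.le, Complex.ofReal_mul]
    | zero => simp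
    | add x y hx hy ex ey =>
      simp only [map_add]
      rw [(summable_of_mem_traceDomain τ (hdom x hx)).tsum_add
          (summable_of_mem_traceDomain τ (hdom y hy)),
        (summable_of_mem_traceDomain τ hx).tsum_add (summable_of_mem_traceDomain τ hy), ex, ey,
        mul_add]
    | smul c x hx ex =>
      simp only [map_smul, smul_eq_mul]
      rw [tsum_mul_left, tsum_mul_left, ex]
      ring

/-- The trace-scaling constants form a subgroup of the positive reals. -/
theorem exists_subgroup_traceScalingGroup {τ : A →ₚ[ℂ] ℂ}
    (hτ : ∀ a b : A, τ (a * b) = τ (b * a)) :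
    ∃ G : Subgroup ℝˣ, traceScalingGroup τ = (fun u : ℝˣ => (u : ℝ)) '' (G : Set ℝˣ) := by
  refine ⟨{ carrier := {u | (u : ℝ) ∈ traceScalingGroup τ}, one_mem' := ?_, mul_mem' := ?_,
            inv_mem' := ?_ }, ?_⟩
  · intro u v hu hv
    rw [Set.mem_ofPred_eq, mem_traceScalingGroup_iff hτ] at hu hv ⊢
    obtain ⟨hu0, α, hα⟩ := hu
    obtain ⟨hv0, β, hβ⟩ := hv
    refine ⟨by rw [Units.val_mul]; exact mul_pos hu0 hv0, β.trans α, fun x hx => ?_⟩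
    rw [StarAlgEquiv.trans_apply, hα _ (map_nonneg β hx), hβ x hx, Units.val_mul,
      ENNReal.ofReal_mul hu0.le, mul_assoc]
  · rw [Set.mem_ofPred_eq, mem_traceScalingGroup_iff hτ]
    exact ⟨by simp, StarAlgEquiv.refl ℂ _, fun x hx => by simp⟩
  · intro u hu
    rw [Set.mem_ofPred_eq] at hu ⊢
    rw [mem_traceScalingGroup_iff hτ] at hu ⊢
    obtain ⟨hu0, α, hα⟩ := hu
    refine ⟨by rw [Units.val_inv_eq_inv_val]; exact inv_pos.mpr hu0, α.symm, fun x hx => ?_⟩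
    have h := hα (α.symm x) (map_nonneg α.symm hx)
    rw [StarAlgEquiv.apply_symm_apply] at h
    rw [h, ← mul_assoc, ← ENNReal.ofReal_mul (by simpa using hu0.le)]
    simp
  · ext t
    refine ⟨fun ht => ⟨Units.mk0 t ht.1.ne', ht, rfl⟩, ?_⟩
    rintro ⟨u, hu, rfl⟩
    exact hu

end Traces

/-! ### Trace-scaling constants are traces of projections -/

/-- Two injective *-homomorphisms into a common *-algebra with the same image of `p M p` and `A`
identify `p M p` with `A`. -/
theorem nonempty_projCorner_starAlgEquiv {M B A : Type*}
    [NonUnitalRing M] [StarRing M] [Module ℂ M] [IsScalarTower ℂ M M] [SMulCommClass ℂ M M]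
    [NonUnitalRing B] [StarRing B] [Module ℂ B] [NonUnitalRing A] [StarRing A] [Module ℂ A]
    {p : M} (hp : IsStarProjection p) (κ : M →⋆ₙₐ[ℂ] B) (hκ : Function.Injective κ)
    (θ : A →⋆ₙₐ[ℂ] B) (hθ : Function.Injective θ) (h₁ : ∀ a, ∃ y, θ a = κ (p * y * p))
    (h₂ : ∀ y, ∃ a, θ a = κ (p * y * p)) : Nonempty (projCorner hp ≃⋆ₐ[ℂ] A) := by
  have h₂' : ∀ x : projCorner hp, ∃ a, θ a = κ x := by
    rintro ⟨_, y, rfl⟩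
    exact h₂ y
  choose g hg using h₂'
  let f : projCorner hp →⋆ₙₐ[ℂ] A :=
    { toFun := g
      map_smul' := fun c x => hθ (by
        rw [hg, MonoidHom.id_apply, map_smul, hg, NonUnitalStarSubalgebra.coe_smul, map_smul])
      map_zero' := hθ (by rw [hg, map_zero, NonUnitalStarSubalgebra.coe_zero, map_zero])
      map_add' := fun x y => hθ (by
        rw [hg, map_add, hg, hg, NonUnitalStarSubalgebra.coe_add, map_add])
      map_mul' := fun x y => hθ (by
        rw [hg, map_mul, hg, hg, NonUnitalStarSubalgebra.coe_mul, map_mul])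
      map_star' := fun x => hθ (by
        rw [hg, map_star, hg]; exact map_star κ (x : M)) }
  refine ⟨StarAlgEquiv.ofBijective f ⟨fun x y hxy => ?_, fun a => ?_⟩⟩
  · have h : θ (g x) = θ (g y) := congrArg θ hxy
    rw [hg, hg] at h
    exact Subtype.ext (hκ h)
  · obtain ⟨y, hy⟩ := h₁ a
    exact ⟨⟨p * y * p, y, rfl⟩, hθ ((hg _).trans hy.symm)⟩

section

variable {A : Type*} [CStarAlgebra A] [PartialOrder A] [StarOrderedRing A]

/-- A positive invertible element has an inverse square root. -/
theorem exists_star_eq_mul_mul_eq_one {c : A} (hc : 0 ≤ c) (hu : IsUnit c) :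
    ∃ d : A, star d = d ∧ d * c * d = 1 := by
  have hr : CFC.sqrt c * CFC.sqrt c = c := CFC.sqrt_mul_sqrt_self c hc
  have hs : star (CFC.sqrt c) = CFC.sqrt c := (CFC.sqrt_nonneg c).isSelfAdjoint
  obtain ⟨v, hv⟩ := ((Commute.refl (CFC.sqrt c)).isUnit_mul_iff.mp (by rwa [hr])).1
  refine ⟨(v⁻¹ : Aˣ), ?_, ?_⟩
  · have : star v = v := Units.ext (by rw [Units.coe_star, hv, hs])
    rw [← Units.coe_star, star_inv, this]
  · rw [← hr, ← hv]
    simp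

/-- The projection `α(e)`, with `e` the unit of `M_1(A)`, is equivalent to a projection `q` in some
`M_n(A)`: if `1_n` almost fixes `α(e)`, then `α(e) 1_n α(e)` is invertible in `α(e) B α(e) ≅ A`, and
the polar decomposition of `1_n α(e)` yields a partial isometry `w` from `α(e)` to `q`. -/
theorem traceScalingGroup_subset_fundamentalGroup {τ : A →ₚ[ℂ] ℂ} (hτ : IsNormalizedTrace τ) :
    traceScalingGroup τ ⊆ fundamentalGroup τ := by
  intro t ht
  rw [mem_traceScalingGroup_iff hτ.2] at ht
  obtain ⟨ht0, α, hα⟩ := ht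
  let φ : A →⋆ₙₐ[ℂ] Stabilization A :=
    (α : Stabilization A →⋆ₙₐ[ℂ] Stabilization A).comp Stabilization.topLeft
  have hφα : ∀ a, φ a = α (Stabilization.topLeft a) := fun a => rfl
  have hφ : Function.Injective φ := α.injective.comp Stabilization.topLeft_injective
  have hφc : ∀ b, φ 1 * b * φ 1 = φ (Stabilization.entry 0 0 (α.symm b)) := by
    intro b
    rw [hφα, hφα, ← Stabilization.topLeft_one_mul_mul, map_mul, map_mul,
      StarAlgEquiv.apply_symm_apply]
  have hstar1 : star (φ 1) = φ 1 := by rw [← map_star, star_one]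
  have hone : φ 1 * φ 1 = φ 1 := by rw [← map_mul, one_mul]
  have hl : ∀ a, φ 1 * φ a = φ a := fun a => by rw [← map_mul, one_mul]
  have hr : ∀ a, φ a * φ 1 = φ a := fun a => by rw [← map_mul, mul_one]
  obtain ⟨n, hn⟩ := (Metric.tendsto_atTop.mp (Stabilization.tendsto_unit_mul (φ 1)) 1 one_pos).imp
    fun n h => h n le_rfl
  set u := Stabilization.unit A n with hu
  have hus : star u = u := Stabilization.star_unit n
  have huu : u * u = u := Stabilization.unit_mul_unit n
  set c := Stabilization.entry 0 0 (α.symm u) with hcdef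
  have hc : φ 1 * u * φ 1 = φ c := hφc u
  have hcpos : 0 ≤ c := by
    refine Stabilization.entry_diag_nonneg 0 (map_nonneg α.symm ?_)
    rw [← huu]
    nth_rewrite 1 [← hus]
    exact star_mul_self_nonneg u
  -- `φ` is isometric and `‖u (φ 1) - φ 1‖ < 1`, so `c` is within distance one of the unit
  have hcunit : IsUnit c := by
    have h1 : ‖φ (c - 1)‖ = ‖c - 1‖ := NonUnitalStarAlgHom.norm_map φ hφ _
    have h2 : φ (c - 1) = φ 1 * (u * φ 1 - φ 1) := by
      rw [map_sub, ← hc, mul_sub, hone, mul_assoc]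
    have h3 : ‖c - 1‖ < 1 := by
      rw [← h1, h2]
      rw [dist_eq_norm] at hn
      refine (norm_mul_le _ _).trans_lt ?_
      have h4 : ‖φ 1‖ ≤ 1 := norm_le_one_of_star_mul_self (by rw [hstar1, hone])
      exact (mul_le_of_le_one_left (norm_nonneg _) h4).trans_lt hn
    have h5 : ‖1 - c‖ < 1 := by rwa [norm_sub_rev]
    simpa using (Units.oneSub (1 - c) h5).isUnit
  obtain ⟨d, hds, hd⟩ := exists_star_eq_mul_mul_eq_one hcpos hcunit
  have hφd : star (φ d) = φ d := by rw [← map_star, hds]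
  obtain ⟨w, hw⟩ : ∃ w, w = u * φ d := ⟨_, rfl⟩
  have hw1 : star w * w = φ 1 := by
    have : star w * w = φ d * (φ 1 * u * φ 1) * φ d := by
      rw [hw, star_mul, hus, hφd]
      simp only [mul_assoc]
      rw [hl, ← mul_assoc u u, huu, ← mul_assoc (φ d) (φ 1), hr]
    rw [this, hc, ← map_mul, ← map_mul, hd]
  have huw : u * w = w := by rw [hw, ← mul_assoc, huu]
  have hwu : star w * u = star w := by rw [← hus, ← star_mul, huw]
  have hwφ : w * φ 1 = w := by rw [hw, mul_assoc, hr]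
  have hφw : φ 1 * star w = star w := by rw [← hstar1, ← star_mul, hwφ]
  -- everything of the form `w b w*` lies in `M_n(A)`
  have hcut : ∀ b, w * b * star w =
      Stabilization.ofCorner n (Stabilization.compress n (w * b * star w)) := by
    intro b
    rw [← Stabilization.unit_mul_mul_unit, ← hu]
    rw [← mul_assoc, ← mul_assoc, huw, mul_assoc (w * b), hwu]
  set q := Stabilization.compress n (w * φ 1 * star w) with hq
  have hκq : Stabilization.ofCorner n q = w * star w := by rw [hq, ← hcut, hwφ]
  have hκ := Stabilization.ofCorner_injective (A := A) n
  have hqproj : IsStarProjection q := by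
    refine ⟨hκ ?_, hκ ?_⟩
    · rw [map_mul, hκq, mul_assoc, ← mul_assoc (star w), hw1, hφw]
    · rw [map_star, hκq, star_mul, star_star]
  -- conjugation by `w` moves the corner at `φ 1` to the corner at `q`
  let θ : A →⋆ₙₐ[ℂ] Stabilization A :=
    { toFun := fun a => w * φ a * star w
      map_smul' := fun k a => by
        rw [map_smul, mul_smul_comm, smul_mul_assoc, MonoidHom.id_apply]
      map_zero' := by simp
      map_add' := fun a b => by rw [map_add, mul_add, add_mul]
      map_mul' := fun a b => by
        simp only [mul_assoc]
        rw [← mul_assoc (star w) w, hw1, ← mul_assoc (φ 1), hl, map_mul, mul_assoc]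
      map_star' := fun a => by
        rw [star_mul, star_mul, star_star, map_star, mul_assoc] }
  have hθdef : ∀ a, θ a = w * φ a * star w := fun a => rfl
  have hθ : Function.Injective θ := by
    intro a b hab
    have h : star w * θ a * w = star w * θ b * w := by rw [hab]
    have h' : ∀ a, star w * θ a * w = φ a := fun a => by
      rw [hθdef, ← mul_assoc, ← mul_assoc, hw1, hl, mul_assoc, hw1, hr]
    rw [h', h'] at h
    exact hφ h
  refine ⟨ht0, n, q, hqproj, nonempty_projCorner_starAlgEquiv hqproj (Stabilization.ofCorner n) hκ
    θ hθ (fun a => ⟨Stabilization.compress n (θ a), ?_⟩) (fun y =>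
      ⟨Stabilization.entry 0 0 (α.symm (star w * Stabilization.ofCorner n y * w)), ?_⟩), ?_⟩
  · rw [map_mul, map_mul, hκq, hθdef, ← hcut]
    simp only [mul_assoc]
    rw [← mul_assoc (star w) w, ← mul_assoc (star w) w, hw1, hφw, ← mul_assoc (φ 1), hl]
  · rw [map_mul (Stabilization.ofCorner n), map_mul (Stabilization.ofCorner n), hκq, hθdef, ← hφc]
    simp only [mul_assoc]
    rw [hφw, ← mul_assoc w (φ 1), hwφ]
  · have hpos : (0 : Stabilization A) ≤ Stabilization.ofCorner n q := by
      rw [hκq]; exact mul_star_self_nonneg w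
    have h1 := tauHat_ofCorner τ hpos
    have he : (0 : Stabilization A) ≤ Stabilization.topLeft 1 := by
      have := star_mul_self_nonneg (Stabilization.topLeft (1 : A))
      rwa [← map_star, ← map_mul, star_one, one_mul] at this
    have h2 : tauHat τ (Stabilization.topLeft 1) = 1 := by
      refine (tauHat_ofFinMat τ (x := FinMat.topLeft (1 : A)) he).trans ?_
      rw [FinMat.tr_eq_sum τ (FinMat.supp_topLeft 1)]
      simp [FinMat.entry_topLeft, hτ.1]
    rw [hκq, ← tauHat_star_mul_self hτ.2, hw1, hφα, hα _ he, h2, mul_one] at h1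
    have hreal : matrixTrace τ q = ((matrixTrace τ q).re : ℂ) := by
      have hsum : matrixTrace τ q = ∑ i ∈ Finset.range n,
          τ (Stabilization.entry i i (Stabilization.ofCorner n q)) := by
        rw [← matrixTrace_compress, Stabilization.compress_ofCorner]
      rw [hsum, Complex.re_sum, Complex.ofReal_sum]
      exact Finset.sum_congr rfl fun i _ => (trace_entry_eq_ofReal τ hpos i).2
    have hre : 0 < (matrixTrace τ q).re := by
      rw [← ENNReal.ofReal_pos, ← h1]
      exact ENNReal.ofReal_pos.mpr ht0
    rw [hreal, (ENNReal.ofReal_eq_ofReal_iff ht0.le hre.le).mp h1]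

end

/-! ### Modules with an algebra-valued hermitian form -/

/-- A left `A`-module with a hermitian `A`-valued form, linear in the first variable: the algebraic
part of the structure of a left Hilbert module. -/
class HermModule (A M : Type*) [Ring A] [StarRing A] [AddCommGroup M] [Module A M] where
  /-- The form of a hermitian module. -/
  toForm : M →+ M →+ A
  toForm_smul : ∀ (a : A) (x y : M), toForm (a • x) y = a * toForm x y
  star_toForm : ∀ x y : M, star (toForm x y) = toForm y x

namespace HermModule

variable (A : Type*) [Ring A] [StarRing A]

section Defs

variable {M : Type*} [AddCommGroup M] [Module A M] [HermModule A M]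

/-- The `A`-valued form of a hermitian module. -/
def form : M →+ M →+ A := toForm

theorem form_smul_left (a : A) (x y : M) : form A (a • x) y = a * form A x y := toForm_smul a x y

theorem star_form (x y : M) : star (form A x y) = form A y x := star_toForm x y

theorem form_smul_right (a : A) (x y : M) : form A x (a • y) = form A x y * star a := by
  rw [← star_form, form_smul_left, star_mul, star_form]

end Defs

section Instances

variable {M N : Type*} [AddCommGroup M] [Module A M] [HermModule A M]
  [AddCommGroup N] [Module A N] [HermModule A N]

instance : HermModule A A where
  toForm := AddMonoidHom.mk' (fun x => (AddMonoidHom.mulLeft x).comp (starAddEquiv : A ≃+ A))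
    fun x y => by ext z; simp [add_mul]
  toForm_smul a x y := by simp [mul_assoc]
  star_toForm x y := by simp

theorem form_self (x y : A) : form A x y = x * star y := rfl

instance : HermModule A (M × N) where
  toForm := AddMonoidHom.mk' (fun x => ((form A x.1).comp (AddMonoidHom.fst M N)) +
      ((form A x.2).comp (AddMonoidHom.snd M N))) fun x y => by
    refine AddMonoidHom.ext fun z => ?_
    simp only [Prod.fst_add, Prod.snd_add, map_add, AddMonoidHom.add_apply,
      AddMonoidHom.comp_apply]
    abel
  toForm_smul a x y := by
    change form A (a • x).1 y.1 + form A (a • x).2 y.2 = a * (form A x.1 y.1 + form A x.2 y.2)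
    rw [Prod.smul_fst, Prod.smul_snd, form_smul_left, form_smul_left, mul_add]
  star_toForm x y := by
    change star (form A x.1 y.1 + form A x.2 y.2) = form A y.1 x.1 + form A y.2 x.2
    rw [star_add, star_form, star_form]

theorem form_prod (x y : M × N) : form A x y = form A x.1 y.1 + form A x.2 y.2 := rfl

instance (S : Submodule A M) : HermModule A S where
  toForm := AddMonoidHom.mk' (fun x => (form A (x : M)).comp S.toAddSubgroup.subtype)
    fun x y => by refine AddMonoidHom.ext fun z => ?_; simp
  toForm_smul a x y := form_smul_left A a (x : M) (y : M)
  star_toForm x y := star_form A (x : M) (y : M)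

/-- The form on finitely supported sequences, as a bundled additive map. -/
def finsuppForm (I : Type*) : (I →₀ M) →+ (I →₀ M) →+ A :=
  Finsupp.liftAddHom fun i =>
    (AddMonoidHom.compHom' (Finsupp.applyAddHom i : (I →₀ M) →+ M)).comp (form A)

theorem finsuppForm_single {I : Type*} (i : I) (m : M) (y : I →₀ M) :
    finsuppForm A I (Finsupp.single i m) y = form A m (y i) := by
  rw [finsuppForm, Finsupp.liftAddHom_apply_single]
  rfl

instance (I : Type*) : HermModule A (I →₀ M) where
  toForm := finsuppForm A I
  toForm_smul a x y := by
    induction x using Finsupp.induction_linear with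
    | zero => simp
    | add f g hf hg => simp [hf, hg, mul_add]
    | single i m => rw [Finsupp.smul_single, finsuppForm_single, finsuppForm_single, form_smul_left]
  star_toForm x y := by
    induction x using Finsupp.induction_linear with
    | zero => simp
    | add f g hf hg => simp [hf, hg]
    | single i m =>
      rw [finsuppForm_single]
      induction y using Finsupp.induction_linear with
      | zero => simp
      | add f g hf hg => simp [← hf, ← hg]
      | single j n =>
        classical
        rw [finsuppForm_single, Finsupp.single_apply, Finsupp.single_apply]
        by_cases h : i = j
        · rw [if_pos h, if_pos h.symm, star_form]
        · rw [if_neg h, if_neg (Ne.symm h), map_zero, map_zero, star_zero]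

theorem form_single_left {I : Type*} (i : I) (m : M) (y : I →₀ M) :
    form A (Finsupp.single i m) y = form A m (y i) := finsuppForm_single A i m y

theorem form_single_right {I : Type*} (i : I) (m : M) (y : I →₀ M) :
    form A y (Finsupp.single i m) = form A (y i) m := by
  rw [← star_form, form_single_left, star_form]

end Instances

/-! ### Isometries of hermitian modules -/

section Isometric

/-- Two hermitian modules are isometric if there is a linear bijection that preserves the forms. -/
def Isometric (M N : Type*) [AddCommGroup M] [Module A M] [HermModule A M]
    [AddCommGroup N] [Module A N] [HermModule A N] : Prop :=
  ∃ U : M ≃ₗ[A] N, ∀ x y, form A (U x) (U y) = form A x y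

variable {A}
variable {M N M' N' : Type*} [AddCommGroup M] [Module A M] [HermModule A M]
  [AddCommGroup N] [Module A N] [HermModule A N]
  [AddCommGroup M'] [Module A M'] [HermModule A M'] [AddCommGroup N'] [Module A N']
  [HermModule A N']

theorem Isometric.refl (M : Type*) [AddCommGroup M] [Module A M] [HermModule A M] :
    Isometric A M M := ⟨LinearEquiv.refl A M, fun _ _ => rfl⟩

theorem Isometric.symm (h : Isometric A M N) : Isometric A N M := by
  obtain ⟨U, hU⟩ := h
  exact ⟨U.symm, fun x y => by rw [← hU, U.apply_symm_apply, U.apply_symm_apply]⟩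

theorem Isometric.trans (h : Isometric A M N) (h' : Isometric A N M') : Isometric A M M' := by
  obtain ⟨U, hU⟩ := h
  obtain ⟨V, hV⟩ := h'
  exact ⟨U.trans V, fun x y => by simp only [LinearEquiv.trans_apply, hV, hU]⟩

theorem Isometric.prod (h : Isometric A M N) (h' : Isometric A M' N') :
    Isometric A (M × M') (N × N') := by
  obtain ⟨U, hU⟩ := h
  obtain ⟨V, hV⟩ := h'
  exact ⟨U.prodCongr V, fun x y => by
    rw [form_prod, form_prod, ← hU, ← hV]; rfl⟩

theorem Isometric.prod_comm : Isometric A (M × N) (N × M) :=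
  ⟨LinearEquiv.prodComm A M N, fun x y => by
    rw [form_prod, form_prod]; exact add_comm _ _⟩

theorem Isometric.prod_assoc : Isometric A ((M × N) × M') (M × (N × M')) :=
  ⟨LinearEquiv.prodAssoc A M N M', fun x y => by
    simp only [form_prod]; exact (add_assoc _ _ _).symm⟩

/-- A linear equivalence from finitely supported sequences is isometric if it is so against
sequences with a single entry. -/
theorem isometric_of_single {I : Type*} (U : (I →₀ M) ≃ₗ[A] N)
    (h : ∀ i m y, form A (U (Finsupp.single i m)) (U y) = form A m (y i)) :
    Isometric A (I →₀ M) N := by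
  refine ⟨U, fun x y => ?_⟩
  induction x using Finsupp.induction_linear with
  | zero => simp
  | add f g hf hg => simp [hf, hg]
  | single i m => rw [h, form_single_left]

theorem Isometric.finsupp (I : Type*) (h : Isometric A M N) :
    Isometric A (I →₀ M) (I →₀ N) := by
  obtain ⟨U, hU⟩ := h
  refine isometric_of_single (Finsupp.mapRange.linearEquiv U) fun i m y => ?_
  rw [Finsupp.mapRange.linearEquiv_apply, Finsupp.mapRange_single, form_single_left,
    Finsupp.mapRange.linearEquiv_apply, Finsupp.mapRange_apply]
  exact hU _ _

theorem isometric_finsupp_equiv {I J : Type*} (e : I ≃ J) :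
    Isometric A (I →₀ M) (J →₀ M) := by
  refine isometric_of_single (Finsupp.domLCongr e) fun i m y => ?_
  rw [Finsupp.domLCongr_single, form_single_left, Finsupp.domLCongr_apply]
  simp

theorem isometric_finsupp_prod :
    Isometric A (ℕ →₀ M × N) ((ℕ →₀ M) × (ℕ →₀ N)) := by
  let U : (ℕ →₀ M × N) ≃ₗ[A] (ℕ →₀ M) × (ℕ →₀ N) := LinearEquiv.ofLinearMap
    ((Finsupp.mapRange.linearMap (LinearMap.fst A M N)).prod
      (Finsupp.mapRange.linearMap (LinearMap.snd A M N)))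
    ((Finsupp.mapRange.linearMap (LinearMap.inl A M N)).coprod
      (Finsupp.mapRange.linearMap (LinearMap.inr A M N)))
    (by
      refine LinearMap.ext fun x => Prod.ext (Finsupp.ext fun i => ?_) (Finsupp.ext fun i => ?_) <;>
      simp)
    (by
      refine LinearMap.ext fun x => Finsupp.ext fun i => ?_
      simp)
  refine isometric_of_single U fun i m y => ?_
  have h : U (Finsupp.single i m) = (Finsupp.single i m.1, Finsupp.single i m.2) := by
    simp [U]
  rw [h, form_prod, form_single_left, form_single_left, form_prod]
  rfl

theorem isometric_finsupp_finsupp : Isometric A (ℕ →₀ ℕ →₀ M) (ℕ →₀ M) := by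
  refine Isometric.trans (Isometric.symm ?_) (isometric_finsupp_equiv Nat.pairEquiv)
  refine isometric_of_single (Finsupp.curryLinearEquiv A) fun i m y => ?_
  have h : Finsupp.curryLinearEquiv A (Finsupp.single i m) =
      Finsupp.single i.1 (Finsupp.single i.2 m) := Finsupp.curry_single i m
  rw [h, form_single_left, form_single_left]
  rfl

theorem isometric_finsupp_prod_self :
    Isometric A ((ℕ →₀ M) × (ℕ →₀ M)) (ℕ →₀ M) := by
  refine Isometric.trans (Isometric.symm ?_) (isometric_finsupp_equiv Equiv.natSumNatEquivNat)
  refine isometric_of_single (Finsupp.sumFinsuppLEquivProdFinsupp A) fun i m y => ?_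
  rw [form_prod]
  rcases i with i | i
  · have h1 : (Finsupp.sumFinsuppLEquivProdFinsupp A (Finsupp.single (Sum.inl i) m) :
        (ℕ →₀ M) × (ℕ →₀ M)) = (Finsupp.single i m, 0) := by
      ext j <;> simp [Finsupp.single_apply]
    rw [h1, form_single_left]
    simp
  · have h1 : (Finsupp.sumFinsuppLEquivProdFinsupp A (Finsupp.single (Sum.inr i) m) :
        (ℕ →₀ M) × (ℕ →₀ M)) = (0, Finsupp.single i m) := by
      ext j <;> simp [Finsupp.single_apply]
    rw [h1, form_single_left]
    simp

/-- A self-adjoint idempotent splits a hermitian module into its range and its kernel. -/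
theorem isometric_eqLocus_prod_ker (P : M →ₗ[A] M) (hP : ∀ x, P (P x) = P x)
    (hPs : ∀ x y, form A (P x) y = form A x (P y)) :
    Isometric A M (LinearMap.eqLocus P LinearMap.id × LinearMap.ker P) := by
  let U : M ≃ₗ[A] LinearMap.eqLocus P LinearMap.id × LinearMap.ker P := LinearEquiv.ofLinearMap
    ((P.codRestrict (LinearMap.eqLocus P LinearMap.id) hP).prod
      ((LinearMap.id - P).codRestrict (LinearMap.ker P) fun x => by simp [hP]))
    ((LinearMap.eqLocus P LinearMap.id).subtype.coprod (LinearMap.ker P).subtype)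
    (by
      refine LinearMap.ext fun ⟨⟨x, hx⟩, ⟨y, hy⟩⟩ => ?_
      have hx' : P x = x := hx
      have hy' : P y = 0 := hy
      refine Prod.ext (Subtype.ext ?_) (Subtype.ext ?_)
      · change P (x + y) = x
        rw [map_add, hx', hy', add_zero]
      · change x + y - P (x + y) = y
        rw [map_add, hx', hy', add_zero, add_sub_cancel_left])
    (by
      refine LinearMap.ext fun x => ?_
      change P x + (x - P x) = x
      exact add_sub_cancel (P x) x)
  refine ⟨U, fun x y => ?_⟩
  change form A (P x) (P y) + form A (x - P x) (y - P y) = form A x y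
  have h1 : form A (P x) (P y) = form A x (P y) := by rw [hPs, hP]
  have h2 : form A (P x) y = form A x (P y) := hPs x y
  simp only [map_sub, AddMonoidHom.sub_apply, h1, h2]
  abel

/-- A vector of square one splits off a copy of the algebra. -/
theorem isometric_prod_ker_of_form_eq_one {v : M} (hv : form A v v = 1) :
    ∃ Z : Submodule A M, Isometric A M (A × Z) := by
  let F : M →ₗ[A] A :=
    { toFun := fun x => form A x v
      map_add' := fun x y => by simp
      map_smul' := fun a x => form_smul_left A a x v }
  have hF : ∀ x, F x = form A x v := fun _ => rfl
  have hFv : F v = 1 := hv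
  let U : M ≃ₗ[A] A × LinearMap.ker F := LinearEquiv.ofLinearMap
    (F.prod ((LinearMap.id - (LinearMap.toSpanSingleton A M v).comp F).codRestrict
      (LinearMap.ker F) fun x => by simp [hFv]))
    ((LinearMap.toSpanSingleton A M v).coprod (LinearMap.ker F).subtype)
    (by
      refine LinearMap.ext fun ⟨a, ⟨y, hy⟩⟩ => ?_
      have hy' : F y = 0 := hy
      refine Prod.ext ?_ (Subtype.ext ?_) <;> simp [hy', hFv])
    (by
      refine LinearMap.ext fun x => ?_
      simp)
  refine ⟨LinearMap.ker F, U, fun x y => ?_⟩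
  change form A x v * star (form A y v) +
    form A (x - form A x v • v) (y - form A y v • v) = form A x y
  simp only [map_sub, AddMonoidHom.sub_apply, form_smul_left, form_smul_right, hv, star_form]
  simp

/-- The swindle: if `M^∞ ≅ N × N'`, then `M^∞ ≅ (M^∞)^∞ ≅ N^∞ × N'^∞`, which absorbs a further copy
of `N^∞`. -/
theorem Isometric.absorb (h : Isometric A (ℕ →₀ M) (N × N')) :
    Isometric A (ℕ →₀ M) ((ℕ →₀ N) × (ℕ →₀ M)) := by
  have h1 : Isometric A (ℕ →₀ M) ((ℕ →₀ N) × (ℕ →₀ N')) :=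
    isometric_finsupp_finsupp.symm.trans ((h.finsupp ℕ).trans isometric_finsupp_prod)
  exact h1.trans (((isometric_finsupp_prod_self.symm.prod (.refl _)).trans
    Isometric.prod_assoc).trans ((Isometric.refl _).prod h1.symm))

/-- If `N` is a summand of `M^∞` and `M` is a summand of `N^∞`, then `M^∞` and `N^∞` absorb each
other, hence are isometric. -/
theorem isometric_finsupp_of_summands (h : Isometric A (ℕ →₀ M) (N × N'))
    (h' : Isometric A (ℕ →₀ N) (M × M')) : Isometric A (ℕ →₀ M) (ℕ →₀ N) :=
  h.absorb.trans (Isometric.prod_comm.trans h'.absorb.symm)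

end Isometric

end HermModule

/-! ### Fullness over a simple algebra -/

namespace HermModule

section Full

variable {A : Type*} [CStarAlgebra A] [PartialOrder A] [StarOrderedRing A]
  {M : Type*} [AddCommGroup M] [Module A M] [HermModule A M]

theorem exists_form_eq_sum (l : List M) :
    ∃ v : ℕ →₀ M, form A v v = (l.map fun x => form A x x).sum := by
  induction l with
  | nil => exact ⟨0, by simp⟩
  | cons x l ih =>
    obtain ⟨v, hv⟩ := ih
    obtain ⟨n, hn⟩ := Infinite.exists_notMem_finset v.support
    rw [Finsupp.notMem_support_iff] at hn
    refine ⟨Finsupp.single n x + v, ?_⟩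
    simp [form_single_left, form_single_right, hn, hv]

variable (A M) in
/-- The additive group generated by the values of the form. -/
def formValues : AddSubgroup A := AddSubgroup.closure {a | ∃ x y : M, form A x y = a}

theorem mul_mem_formValues (a : A) {s : A} (hs : s ∈ formValues A M) :
    a * s ∈ formValues A M ∧ s * a ∈ formValues A M := by
  induction hs using AddSubgroup.closure_induction with
  | mem s hs =>
    obtain ⟨x, y, rfl⟩ := hs
    refine ⟨AddSubgroup.subset_closure ⟨a • x, y, form_smul_left A a x y⟩,
      AddSubgroup.subset_closure ⟨x, star a • y, ?_⟩⟩
    rw [form_smul_right, star_star]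
  | zero => simp
  | add s t _ _ hs ht =>
    rw [mul_add, add_mul]
    exact ⟨add_mem hs.1 ht.1, add_mem hs.2 ht.2⟩
  | neg s _ hs =>
    rw [mul_neg, neg_mul]
    exact ⟨neg_mem hs.1, neg_mem hs.2⟩

/-- Polarization: the real part of a sum of values of the form is dominated by a sum of squares. -/
theorem exists_le_sum_form (hpos : ∀ x : M, 0 ≤ form A x x) {s : A}
    (hs : s ∈ formValues A M) : ∃ l : List M,
      s + star s ≤ (l.map fun x => form A x x).sum ∧
      -(s + star s) ≤ (l.map fun x => form A x x).sum := by
  induction hs using AddSubgroup.closure_induction with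
  | mem s hs =>
    obtain ⟨x, y, rfl⟩ := hs
    refine ⟨[x, y], ?_, ?_⟩
    · have h := hpos (x - y)
      rw [← sub_nonneg]
      refine h.trans_eq ?_
      simp only [map_sub, AddMonoidHom.sub_apply, star_form, List.map_cons, List.map_nil,
        List.sum_cons, List.sum_nil]
      abel
    · have h := hpos (x + y)
      rw [← sub_nonneg]
      refine h.trans_eq ?_
      simp only [map_add, AddMonoidHom.add_apply, star_form, List.map_cons, List.map_nil,
        List.sum_cons, List.sum_nil]
      abel
  | zero => exact ⟨[], by simp, by simp⟩
  | add s t _ _ hs ht =>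
    obtain ⟨l, h1, h2⟩ := hs
    obtain ⟨l', h1', h2'⟩ := ht
    refine ⟨l ++ l', ?_, ?_⟩ <;> rw [List.map_append, List.sum_append]
    · refine (add_le_add h1 h1').trans_eq' ?_
      rw [star_add]; abel
    · refine (add_le_add h2 h2').trans_eq' ?_
      rw [star_add]; abel
  | neg s _ hs =>
    obtain ⟨l, h1, h2⟩ := hs
    refine ⟨l, h2.trans_eq' ?_, h1.trans_eq' ?_⟩ <;> rw [star_neg] <;> abel

/-- Over a simple C*-algebra, a nonzero positive hermitian module `M` is full: the closed ideal
generated by the values of the form contains `1`, and `M^∞` contains a vector of square one. -/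
theorem exists_form_eq_one (hA : IsSimpleCStarAlgebra A) (hpos : ∀ x : M, 0 ≤ form A x x)
    (hne : ∃ x y : M, form A x y ≠ 0) : ∃ v : ℕ →₀ M, form A v v = 1 := by
  let J := formValues A M
  let I : TwoSidedIdeal A := .mk' (closure (J : Set A)) J.topologicalClosure.zero_mem
    (fun hx hy => J.topologicalClosure.add_mem hx hy) (fun hx => J.topologicalClosure.neg_mem hx)
    (fun {x y} hy => map_mem_closure (continuous_const_mul x) hy fun s hs =>
      (mul_mem_formValues x hs).1)
    (fun {x y} hx => map_mem_closure (f := fun z => z * y) (continuous_mul_const y) hx fun s hs =>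
      (mul_mem_formValues y hs).2)
  have hIc : (I : Set A) = closure (J : Set A) := TwoSidedIdeal.coe_mk' _ _ _ _ _ _
  have hI : I = ⊤ := by
    refine (hA.2 I (by rw [hIc]; exact isClosed_closure)).resolve_left fun h => ?_
    obtain ⟨x, y, hxy⟩ := hne
    have hm : form A x y ∈ (I : Set A) := by
      rw [hIc]
      exact subset_closure (AddSubgroup.subset_closure ⟨x, y, rfl⟩)
    rw [h] at hm
    exact hxy hm
  have h1 : (1 : A) ∈ closure (J : Set A) := by
    rw [← hIc, hI]
    trivial
  obtain ⟨s, hs, hds⟩ := Metric.mem_closure_iff.mp h1 (1 / 2) (by norm_num)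
  obtain ⟨l, hl, -⟩ := exists_le_sum_form hpos hs
  obtain ⟨v, hv⟩ := exists_form_eq_sum (A := A) l
  rw [← hv] at hl
  -- `1 ≤ s + s*` because `s` is within `1/2` of `1`
  have hone : (1 : A) ≤ form A v v := by
    refine le_trans ?_ hl
    set h := (1 - s) + star (1 - s) with hh
    have hsa : IsSelfAdjoint h := IsSelfAdjoint.add_star_self (1 - s)
    have hn : ‖h‖ ≤ 1 := by
      rw [dist_eq_norm] at hds
      refine (norm_add_le _ _).trans ?_
      rw [norm_star]
      linarith
    have hle : h ≤ 1 := by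
      refine hsa.le_algebraMap_norm_self.trans ?_
      rw [← map_one (algebraMap ℝ A)]
      exact algebraMap_mono A hn
    have : s + star s = 1 + (1 - h) := by
      rw [hh, star_sub, star_one]; abel
    rw [this]
    exact le_add_of_nonneg_right (sub_nonneg.mpr hle)
  have hunit : IsUnit (form A v v) := CStarAlgebra.isUnit_of_le 1 hone
  obtain ⟨d, hd, hdv⟩ := exists_star_eq_mul_mul_eq_one (zero_le_one.trans hone) hunit
  exact ⟨d • v, by rw [form_smul_left, form_smul_right, hd, ← mul_assoc, hdv]⟩

end Full

end HermModule

/-! ### Finitely supported matrices acting on row vectors -/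

namespace FinMat

open HermModule

section Rows

variable {A : Type*} [Ring A] [StarRing A] [Algebra ℂ A] [StarModule ℂ A]

/-- The rows of a finitely supported matrix. -/
def row (b : FinMat A) (i : ℕ) : ℕ →₀ A :=
  Finsupp.onFinset (Finset.range b.bound) (fun j => b.entry i j) fun j hj => by
    by_contra hn
    exact hj (b.supp_bound i j (Or.inr (by simpa using hn)))

@[simp] theorem row_apply (b : FinMat A) (i j : ℕ) : row b i j = b.entry i j := rfl

theorem row_eq_zero (b : FinMat A) {i : ℕ} (hi : b.bound ≤ i) : row b i = 0 :=
  Finsupp.ext fun j => b.supp_bound i j (Or.inl hi)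

theorem exists_row_eq (f : ℕ → ℕ →₀ A) (n : ℕ) (hf : ∀ k, n ≤ k → f k = 0) :
    ∃ b : FinMat A, ∀ k, row b k = f k := by
  obtain ⟨m, hm⟩ := Finset.exists_nat_subset_range ((Finset.range n).biUnion fun k => (f k).support)
  refine ⟨mk (max n m) (fun k i => f k i) fun k i h => ?_, fun k => Finsupp.ext fun i => rfl⟩
  by_cases hk : n ≤ k
  · rw [hf k hk, Finsupp.zero_apply]
  · by_contra hne
    have : i ∈ Finset.range m := hm (Finset.mem_biUnion.mpr
      ⟨k, by simpa using hk, Finsupp.mem_support_iff.mpr hne⟩)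
    rw [Finset.mem_range] at this
    omega

theorem form_eq_sum {n : ℕ} {x : ℕ →₀ A} (hx : ∀ k, n ≤ k → x k = 0) (y : ℕ →₀ A) :
    form A x y = ∑ k ∈ Finset.range n, x k * star (y k) := by
  have h : x = ∑ k ∈ Finset.range n, Finsupp.single k (x k) := by
    refine Finsupp.ext fun i => ?_
    rw [Finsupp.finsetSum_apply]
    simp only [Finsupp.single_apply, Finset.sum_ite_eq', Finset.mem_range]
    split_ifs with h
    · rfl
    · exact hx i (not_lt.mp h)
  conv_lhs => rw [h]
  rw [map_sum, AddMonoidHom.finsetSum_apply]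
  exact Finset.sum_congr rfl fun k _ => (form_single_left A k (x k) y).trans (form_self A _ _)

theorem form_row_row (b c : FinMat A) (i j : ℕ) :
    form A (row b i) (row c j) = (b * star c).entry i j := by
  rw [form_eq_sum (n := b.bound) fun k hk => b.supp_bound i k (Or.inr hk),
    entry_mul_eq_sum (Or.inl b.supp_bound), Finset.sum_range]
  rfl

/-- The action of matrices on row vectors from the right. -/
def vecMul (b : FinMat A) : (ℕ →₀ A) →ₗ[A] (ℕ →₀ A) := Finsupp.linearCombination A (row b)

theorem vecMul_single (b : FinMat A) (i : ℕ) (a : A) :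
    vecMul b (Finsupp.single i a) = a • row b i := Finsupp.linearCombination_single A a i

theorem vecMul_apply (b : FinMat A) (x : ℕ →₀ A) (j : ℕ) :
    vecMul b x j = form A x (row (star b) j) := by
  induction x using Finsupp.induction_linear with
  | zero => simp
  | add f g hf hg => simp [hf, hg]
  | single i a =>
    rw [vecMul_single, form_single_left, form_self, row_apply, entry_star, star_star]
    rfl

theorem vecMul_row (b c : FinMat A) (i : ℕ) : vecMul c (row b i) = row (b * c) i :=
  Finsupp.ext fun j => by rw [vecMul_apply, form_row_row, star_star, row_apply]

theorem vecMul_mul (b c : FinMat A) (x : ℕ →₀ A) :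
    vecMul (b * c) x = vecMul c (vecMul b x) := by
  induction x using Finsupp.induction_linear with
  | zero => simp
  | add f g hf hg => simp [hf, hg]
  | single i a => rw [vecMul_single, vecMul_single, map_smul, vecMul_row]

theorem form_vecMul (b : FinMat A) (x y : ℕ →₀ A) :
    form A (vecMul b x) y = form A x (vecMul (star b) y) := by
  induction x using Finsupp.induction_linear with
  | zero => simp
  | add f g hf hg => simp [hf, hg]
  | single i a =>
    rw [vecMul_single, form_smul_left, form_single_left, form_self, vecMul_apply, star_star,
      star_form]

/-- The entries, as additive maps. -/
def entryHom (i j : ℕ) : FinMat A →+ A where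
  toFun x := x.entry i j
  map_zero' := rfl
  map_add' _ _ := rfl

/-- The range of an idempotent matrix on row vectors, encoded as the module of fixed vectors. -/
def RowRange (p : FinMat A) : Type _ :=
  (LinearMap.eqLocus (vecMul p) LinearMap.id : Submodule A (ℕ →₀ A))

namespace RowRange

variable {p : FinMat A}

instance : AddCommGroup (RowRange p) := inferInstanceAs
  (AddCommGroup (LinearMap.eqLocus (vecMul p) LinearMap.id : Submodule A (ℕ →₀ A)))

instance : Module A (RowRange p) := inferInstanceAs
  (Module A (LinearMap.eqLocus (vecMul p) LinearMap.id : Submodule A (ℕ →₀ A)))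

instance : HermModule A (RowRange p) := inferInstanceAs
  (HermModule A (LinearMap.eqLocus (vecMul p) LinearMap.id : Submodule A (ℕ →₀ A)))

/-- The inclusion of the range of a matrix into the row vectors. -/
def val : RowRange p →ₗ[A] (ℕ →₀ A) :=
  (LinearMap.eqLocus (vecMul p) LinearMap.id : Submodule A (ℕ →₀ A)).subtype

theorem ext {x y : RowRange p} (h : val x = val y) : x = y := Subtype.ext h

theorem vecMul_val (x : RowRange p) : vecMul p (val x) = val x := x.2

theorem form_val (x y : RowRange p) : form A x y = form A (val x) (val y) := rfl

/-- An idempotent matrix as a map onto its range. -/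
def proj (hpp : p * p = p) : (ℕ →₀ A) →ₗ[A] RowRange p :=
  (vecMul p).codRestrict (LinearMap.eqLocus (vecMul p) LinearMap.id) fun x => by
    change vecMul p (vecMul p x) = vecMul p x
    rw [← vecMul_mul, hpp]

theorem val_proj (hpp : p * p = p) (x : ℕ →₀ A) : val (proj hpp x) = vecMul p x := rfl

theorem proj_val (hpp : p * p = p) (x : RowRange p) : proj hpp (val x) = x :=
  ext (vecMul_val x)

/-- The range of a projection is a summand of the row vectors. -/
theorem isometric_prod (hpp : p * p = p) (hps : star p = p) :
    Isometric A (ℕ →₀ A) (RowRange p × LinearMap.ker (vecMul p)) :=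
  isometric_eqLocus_prod_ker (vecMul p) (fun x => by rw [← vecMul_mul, hpp])
    fun x y => by rw [form_vecMul, hps]

/-- The rows of an idempotent matrix lie in its range. -/
def rowOf (hpp : p * p = p) (k : ℕ) : RowRange p := proj hpp (Finsupp.single k 1)

theorem val_rowOf (hpp : p * p = p) (k : ℕ) : val (rowOf hpp k) = row p k := by
  rw [rowOf, val_proj, vecMul_single, one_smul]

end RowRange

open RowRange in
/-- A full projection `p` among the finitely supported matrices has infinitely many orthogonal
copies that exhaust the whole space: with `X` the range of `p` on row vectors, `w j` is the `j`-th
component of an isometry between `X^∞` and `A^∞`. -/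
theorem exists_partialIsometries_of_form_eq_one {p : FinMat A} (hpp : p * p = p)
    (hps : star p = p) {v : ℕ →₀ RowRange p} (hv : form A v v = 1) :
    ∃ w : ℕ → FinMat A, (∀ i j, w i * star (w j) = if i = j then p else 0) ∧
      ∀ b : FinMat A, ∃ s : Finset ℕ, ∑ j ∈ s, b * (star (w j) * w j) = b := by
  obtain ⟨Z, hZ⟩ := isometric_prod_ker_of_form_eq_one hv
  -- `X` is a summand of `A^∞`, and `A` is a summand of `X^∞`
  obtain ⟨V, hV⟩ : Isometric A (ℕ →₀ RowRange p) (ℕ →₀ A) :=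
    (isometric_finsupp_of_summands (isometric_prod hpp hps) hZ).symm
  have hrow : ∀ j, ∃ b : FinMat A, ∀ k, row b k = V (Finsupp.single j (rowOf hpp k)) := fun j =>
    exists_row_eq _ p.bound fun k hk => by
      have : rowOf hpp k = 0 := RowRange.ext (by rw [val_rowOf, row_eq_zero p hk, map_zero])
      rw [this, Finsupp.single_zero, map_zero]
  choose w hw using hrow
  -- `(w j)*` takes a row vector to the `j`-th component of its image in `X^∞`
  have hstar : ∀ j y, vecMul (star (w j)) y = val (V.symm y j) := by
    intro j y
    refine Finsupp.ext fun k => ?_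
    have h1 : form A y (V (Finsupp.single j (rowOf hpp k))) =
        form A (V.symm y) (Finsupp.single j (rowOf hpp k)) := by
      rw [← hV, V.apply_symm_apply]
    rw [vecMul_apply, star_star, hw, h1, form_single_right, form_val, val_rowOf]
    have h2 := vecMul_apply p (val (V.symm y j)) k
    rw [hps, vecMul_val] at h2
    exact h2.symm
  have hmul : ∀ j y, vecMul (star (w j) * w j) y = V (Finsupp.single j (V.symm y j)) := by
    intro j y
    let L : (ℕ →₀ A) →ₗ[A] (ℕ →₀ A) :=
      (V : (ℕ →₀ RowRange p) →ₗ[A] (ℕ →₀ A)).comp ((Finsupp.lsingle j).comp (proj hpp))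
    have hL : ∀ x, L x = V (Finsupp.single j (proj hpp x)) := fun x => rfl
    have h1 : ∀ x, vecMul (w j) x = L x := by
      intro x
      induction x using Finsupp.induction_linear with
      | zero => simp
      | add f g hf hg => simp [hf, hg]
      | single i a =>
        have h2 : proj hpp (Finsupp.single i a) = a • rowOf hpp i :=
          RowRange.ext (by
            rw [val_proj, vecMul_single, map_smul, val_rowOf])
        rw [vecMul_single, hL, h2, hw, ← Finsupp.smul_single, map_smul]
    rw [vecMul_mul, hstar, h1, hL, proj_val]
  refine ⟨w, fun i j => ?_, fun b => ?_⟩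
  · ext k l
    rw [← form_row_row, hw, hw, hV, form_single_left]
    split_ifs with h
    · rw [h, Finsupp.single_eq_same, form_val, val_rowOf, val_rowOf, form_row_row, hps, hpp]
    · rw [Finsupp.single_eq_of_ne h, map_zero, entry_zero]
  -- the rows of `b` are finitely many, and their images in `X^∞` have finite support
  · refine ⟨(Finset.range b.bound).biUnion fun k => (V.symm (row b k)).support, ?_⟩
    set s := (Finset.range b.bound).biUnion fun k => (V.symm (row b k)).support with hs
    ext i l
    change entryHom i l _ = _
    rw [map_sum]
    change ∑ j ∈ s, row (b * (star (w j) * w j)) i l = row b i l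
    simp only [← vecMul_row, hmul]
    rw [← Finsupp.finsetSum_apply, ← map_sum]
    have h1 : ∑ j ∈ s, Finsupp.single j (V.symm (row b i) j) = V.symm (row b i) := by
      refine Finsupp.ext fun k => ?_
      rw [Finsupp.finsetSum_apply]
      simp only [Finsupp.single_apply, Finset.sum_ite_eq']
      split_ifs with hk
      · rfl
      · by_contra hne
        refine hk (Finset.mem_biUnion.mpr ⟨i, ?_, Finsupp.mem_support_iff.mpr (Ne.symm hne)⟩)
        rw [Finset.mem_range]
        by_contra hi
        rw [row_eq_zero b (not_lt.mp hi), map_zero] at hne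
        exact hne rfl
    rw [h1, V.apply_symm_apply]

end Rows

section Partial

variable {A : Type*} [CStarAlgebra A] [PartialOrder A] [StarOrderedRing A]

/-- Over a simple algebra, every nonzero projection is full. -/
theorem exists_partialIsometries (hA : IsSimpleCStarAlgebra A) {p : FinMat A} (hpp : p * p = p)
    (hps : star p = p) (hp : p ≠ 0) :
    ∃ w : ℕ → FinMat A, (∀ i j, w i * star (w j) = if i = j then p else 0) ∧
      ∀ b : FinMat A, ∃ s : Finset ℕ, ∑ j ∈ s, b * (star (w j) * w j) = b := by
  have hpos : ∀ x : RowRange p, 0 ≤ form A x x := fun x => by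
    obtain ⟨n, hn⟩ := Finset.exists_nat_subset_range (RowRange.val x).support
    rw [RowRange.form_val, form_eq_sum (n := n) fun k hk => by
      by_contra h
      exact absurd (Finset.mem_range.mp (hn (Finsupp.mem_support_iff.mpr h))) (not_lt.mpr hk)]
    exact Finset.sum_nonneg fun k _ => mul_star_self_nonneg _
  have hne : ∃ x y : RowRange p, form A x y ≠ 0 := by
    by_contra! h
    refine hp (FinMat.ext fun i j => ?_)
    have := h (RowRange.rowOf hpp i) (RowRange.rowOf hpp j)
    rwa [RowRange.form_val, RowRange.val_rowOf, RowRange.val_rowOf, form_row_row, hps, hpp] at this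
  obtain ⟨v, hv⟩ := exists_form_eq_one hA hpos hne
  exact exists_partialIsometries_of_form_eq_one hpp hps hv

end Partial

end FinMat

/-! ### The automorphism attached to a projection -/

section Extend

variable {A : Type*} [CStarAlgebra A] [PartialOrder A] [StarOrderedRing A]

/-- Automorphisms of `⋃ₙ M_n(A)` are isometric, by uniqueness of the C*-norm of each `M_n(A)`. -/
theorem FinMat.norm_starAlgEquiv (Θ : FinMat A ≃⋆ₐ[ℂ] FinMat A) (x : FinMat A) : ‖Θ x‖ = ‖x‖ := by
  let κ : CStarMatrix (Fin x.bound) (Fin x.bound) A →⋆ₙₐ[ℂ] Stabilization A :=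
    ((Stabilization.ofFinMatHom (A := A)).comp (Θ : FinMat A →⋆ₙₐ[ℂ] FinMat A)).comp
      (FinMat.ofCorner (A := A) x.bound)
  have hκ : Function.Injective κ := Stabilization.ofFinMat_injective.comp
    (Θ.injective.comp (FinMat.ofCorner_injective x.bound))
  have h := NonUnitalStarAlgHom.norm_map κ hκ (FinMat.corner x.bound x)
  have h2 : κ (FinMat.corner x.bound x) = Stabilization.ofFinMat (Θ x) := by
    change Stabilization.ofFinMat (Θ (FinMat.ofCorner x.bound (FinMat.corner x.bound x))) = _
    rw [FinMat.ofCorner_corner x.supp_bound]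
  rw [h2, LinearIsometry.norm_map] at h
  rw [h, FinMat.norm_eq x.supp_bound]

namespace Stabilization

/-- The continuous extension of an automorphism of `⋃ₙ M_n(A)`, as a continuous linear map. -/
def mapCLM (Θ : FinMat A ≃⋆ₐ[ℂ] FinMat A) : Stabilization A →L[ℂ] Stabilization A :=
  (LinearMap.mkContinuous
    { toFun := fun x => ofFinMat (Θ x)
      map_add' := fun x y => by rw [map_add, map_add]
      map_smul' := fun c x => by rw [map_smul, map_smul, RingHom.id_apply] } 1 fun x => by
        rw [one_mul]
        exact ((ofFinMat.norm_map _).trans (FinMat.norm_starAlgEquiv Θ x)).le :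
    FinMat A →L[ℂ] Stabilization A).extend (ofFinMat (A := A)).toContinuousLinearMap

theorem mapCLM_ofFinMat (Θ : FinMat A ≃⋆ₐ[ℂ] FinMat A) (x : FinMat A) :
    mapCLM Θ (ofFinMat x) = ofFinMat (Θ x) :=
  ContinuousLinearMap.extend_eq (e := (ofFinMat (A := A)).toContinuousLinearMap) _
    denseRange_ofFinMat ofFinMat.isometry.isUniformInducing x

theorem mapCLM_symm_mapCLM (Θ : FinMat A ≃⋆ₐ[ℂ] FinMat A) (x : Stabilization A) :
    mapCLM Θ.symm (mapCLM Θ x) = x := by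
  refine ind₁ x (isClosed_eq (by fun_prop) (by fun_prop)) fun x => ?_
  rw [mapCLM_ofFinMat, mapCLM_ofFinMat, StarAlgEquiv.symm_apply_apply]

/-- The extension of an automorphism of `⋃ₙ M_n(A)` to `A ⊗ K(H)`. -/
def mapEquiv (Θ : FinMat A ≃⋆ₐ[ℂ] FinMat A) : Stabilization A ≃⋆ₐ[ℂ] Stabilization A where
  toFun := mapCLM Θ
  invFun := mapCLM Θ.symm
  left_inv := mapCLM_symm_mapCLM Θ
  right_inv := mapCLM_symm_mapCLM Θ.symm
  map_mul' x y := by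
    refine ind₂ x y (isClosed_eq (by fun_prop) (by fun_prop)) fun x y => ?_
    rw [← ofFinMat_mul, mapCLM_ofFinMat, mapCLM_ofFinMat, mapCLM_ofFinMat, map_mul, ofFinMat_mul]
  map_add' := map_add _
  map_star' x := by
    refine ind₁ x (isClosed_eq (by fun_prop) (by fun_prop)) fun x => ?_
    rw [← ofFinMat_star, mapCLM_ofFinMat, mapCLM_ofFinMat, map_star, ofFinMat_star]
  map_smul' := map_smul _

theorem mapEquiv_ofFinMat (Θ : FinMat A ≃⋆ₐ[ℂ] FinMat A) (x : FinMat A) :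
    mapEquiv Θ (ofFinMat x) = ofFinMat (Θ x) := mapCLM_ofFinMat Θ x

theorem mapEquiv_mapEquiv_symm (Θ : FinMat A ≃⋆ₐ[ℂ] FinMat A) (x : Stabilization A) :
    mapEquiv Θ (mapEquiv Θ.symm x) = x := mapCLM_symm_mapCLM Θ.symm x

end Stabilization

/-- An automorphism of `⋃ₙ M_n(A)` that scales the trace extends to one of `A ⊗ K(H)` that scales
the extended trace. -/
theorem mem_traceScalingGroup_of_tr {τ : A →ₚ[ℂ] ℂ} (hτ : ∀ a b : A, τ (a * b) = τ (b * a)) {t : ℝ}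
    (ht : 0 < t) (Θ : FinMat A ≃⋆ₐ[ℂ] FinMat A)
    (hΘ : ∀ x, FinMat.tr τ x = t * FinMat.tr τ (Θ x)) : t ∈ traceScalingGroup τ := by
  have scale : ∀ (Φ : FinMat A ≃⋆ₐ[ℂ] FinMat A) (r : ℝ), 0 < r →
      (∀ x, FinMat.tr τ (Φ x) = r * FinMat.tr τ x) →
      ∀ y, 0 ≤ y → ENNReal.ofReal r * tauHat τ y ≤ tauHat τ (Stabilization.mapEquiv Φ y) := by
    intro Φ r hr hΦ y hy
    refine mul_tauHat_le hτ _ _ (fun x hx => ?_) hy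
    have hx' := map_nonneg (Stabilization.mapEquiv Φ) hx
    rw [Stabilization.mapEquiv_ofFinMat] at hx' ⊢
    rw [tauHat_ofFinMat τ hx, tauHat_ofFinMat τ hx', hΦ, Complex.re_ofReal_mul,
      ENNReal.ofReal_mul hr.le]
  have h1 := scale Θ.symm t ht fun x => by rw [hΘ (Θ.symm x), StarAlgEquiv.apply_symm_apply]
  have h2 := scale Θ t⁻¹ (inv_pos.mpr ht) fun x => by
    rw [hΘ x, ← mul_assoc, ← Complex.ofReal_mul, inv_mul_cancel₀ ht.ne', Complex.ofReal_one,
      one_mul]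
  refine (mem_traceScalingGroup_iff hτ).mpr
    ⟨ht, Stabilization.mapEquiv Θ.symm, fun x hx => le_antisymm ?_ (h1 x hx)⟩
  have h3 := h2 (Stabilization.mapEquiv Θ.symm x) (map_nonneg _ hx)
  rw [Stabilization.mapEquiv_mapEquiv_symm] at h3
  calc tauHat τ (Stabilization.mapEquiv Θ.symm x)
      = ENNReal.ofReal t * (ENNReal.ofReal t⁻¹ *
          tauHat τ (Stabilization.mapEquiv Θ.symm x)) := by
        rw [← mul_assoc, ← ENNReal.ofReal_mul ht.le, mul_inv_cancel₀ ht.ne', ENNReal.ofReal_one,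
          one_mul]
    _ ≤ ENNReal.ofReal t * tauHat τ x := by gcongr

end Extend

namespace FinMat

section Corner

variable {A : Type*} [Ring A] [StarRing A] [Algebra ℂ A] [StarModule ℂ A]

/-- The general `star_mul`, with the multiplication of `FinMat` in the form used for rewriting. -/
protected theorem star_mul (x y : FinMat A) : star (x * y) = star y * star x :=
  StarMul.star_mul x y

/-- If the projections `(w j)* w j`, `j ∈ s`, act as a unit on `b` from the right, then all others
annihilate `b`, and `s` may be enlarged. -/
theorem sum_mul_eq_of_subset {p : FinMat A} {w : ℕ → FinMat A}
    (hw : ∀ i j, w i * star (w j) = if i = j then p else 0) {b : FinMat A} {s : Finset ℕ}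
    (hs : ∑ j ∈ s, b * (star (w j) * w j) = b) {s' : Finset ℕ} (hss : s ⊆ s') :
    (∀ k, k ∉ s → b * star (w k) = 0) ∧ ∑ j ∈ s', b * (star (w j) * w j) = b := by
  have h0 : ∀ k, k ∉ s → b * star (w k) = 0 := by
    intro k hk
    rw [← hs, Finset.sum_mul]
    refine Finset.sum_eq_zero fun j hj => ?_
    rw [mul_assoc, mul_assoc, hw, if_neg (by rintro rfl; exact hk hj), mul_zero, mul_zero]
  refine ⟨h0, ?_⟩
  rw [← hs]
  nth_rewrite 1 [hs]
  exact (Finset.sum_subset hss fun k _ hk => by rw [← mul_assoc, h0 k hk, zero_mul]).symm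

/-- If `ψ` identifies `A` with the corner at `p = ψ 1`, and the `w j` are partial isometries from
orthogonal projections that exhaust the space to `p`, then taking the corner-valued matrix entries
`w i b (w j)*` of `b` is an automorphism of `⋃ₙ M_n(A)`. -/
theorem exists_starAlgEquiv {p : FinMat A} (ψ : A →⋆ₙₐ[ℂ] FinMat A) (hψ : Function.Injective ψ)
    (hψp : ψ 1 = p) (hψr : ∀ x, ∃ a, ψ a = p * x * p) (w : ℕ → FinMat A)
    (hw : ∀ i j, w i * star (w j) = if i = j then p else 0)
    (hw' : ∀ b : FinMat A, ∃ s : Finset ℕ, ∑ j ∈ s, b * (star (w j) * w j) = b) :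
    ∃ Θ : FinMat A ≃⋆ₐ[ℂ] FinMat A, ∀ b i j, ψ ((Θ b).entry i j) = w i * b * star (w j) := by
  have hpp : p * p = p := by rw [← hψp, ← map_mul, one_mul]
  have hps : star p = p := by rw [← hψp, ← map_star, star_one]
  have hpw : ∀ j, p * w j = w j := by
    intro j
    obtain ⟨s, hs⟩ := hw' (w j)
    rw [← hs]
    simp only [← mul_assoc, hw, ite_mul, zero_mul, Finset.mul_sum, mul_ite, mul_zero, hpp]
  have hwp : ∀ j, star (w j) * p = star (w j) := fun j => by
    rw [← hps, ← FinMat.star_mul, hpw]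
  have hg : ∀ b i j, ∃ a, ψ a = w i * b * star (w j) := by
    intro b i j
    obtain ⟨a, ha⟩ := hψr (w i * b * star (w j))
    refine ⟨a, ha.trans ?_⟩
    rw [mul_assoc, mul_assoc, hwp, ← mul_assoc, ← mul_assoc, hpw]
  choose g hg using hg
  have hbound : ∀ b, ∃ n, ∀ i j, n ≤ i ∨ n ≤ j → g b i j = 0 := by
    intro b
    obtain ⟨s, hs⟩ := hw' b
    obtain ⟨s', hs'⟩ := hw' (star b)
    obtain ⟨n, hn⟩ := Finset.exists_nat_subset_range (s ∪ s')
    refine ⟨n, fun i j hij => hψ ?_⟩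
    rw [hg, map_zero]
    rcases hij with h | h
    · have h0 := (sum_mul_eq_of_subset hw hs' subset_rfl).1 i fun hi =>
        absurd (Finset.mem_range.mp (hn (Finset.mem_union_right _ hi))) (not_lt.mpr h)
      have h1 := congrArg star h0
      rw [FinMat.star_mul, star_star, star_star, star_zero] at h1
      rw [h1, zero_mul]
    · have h0 := (sum_mul_eq_of_subset hw hs subset_rfl).1 j fun hj =>
        absurd (Finset.mem_range.mp (hn (Finset.mem_union_left _ hj))) (not_lt.mpr h)
      rw [mul_assoc, h0, mul_zero]
  choose n hn using hbound
  let Θ : FinMat A →⋆ₙₐ[ℂ] FinMat A :=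
    { toFun := fun b => mk (n b) (g b) (hn b)
      map_smul' := fun c b => by
        ext i j
        refine hψ ?_
        rw [entry_mk, hg, MonoidHom.id_apply, entry_smul, entry_mk, map_smul, hg, mul_smul_comm,
          smul_mul_assoc]
      map_zero' := by
        ext i j
        refine hψ ?_
        rw [entry_mk, hg, entry_zero, map_zero, mul_zero, zero_mul]
      map_add' := fun b c => by
        ext i j
        refine hψ ?_
        rw [entry_mk, hg, entry_add, entry_mk, entry_mk, map_add, hg, hg, mul_add, add_mul]
      map_mul' := fun b c => by
        ext i j
        refine hψ ?_
        obtain ⟨s, hs⟩ := hw' b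
        obtain ⟨m, hm⟩ := Finset.exists_nat_subset_range (s ∪ Finset.range (n b))
        have hsm : s ⊆ Finset.range m := Finset.subset_union_left.trans hm
        have hnm : Supp m (mk (n b) (g b) (hn b)) := (supp_mk _ _ _).mono (by
          have := Finset.subset_union_right.trans hm
          exact Finset.range_subset_range.mp this)
        rw [entry_mk, hg, entry_mul_eq_sum (Or.inl hnm), map_sum]
        have h1 := (sum_mul_eq_of_subset hw hs hsm).2
        nth_rewrite 1 [← h1]
        rw [Finset.sum_mul, Finset.mul_sum, Finset.sum_mul, Finset.sum_range]
        refine Finset.sum_congr rfl fun k _ => ?_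
        rw [map_mul, entry_mk, entry_mk, hg, hg]
        simp only [mul_assoc]
      map_star' := fun b => by
        ext i j
        refine hψ ?_
        rw [entry_mk, hg, entry_star, entry_mk, map_star, hg, FinMat.star_mul,
          FinMat.star_mul, star_star, mul_assoc] }
  have hΘ : ∀ b i j, ψ ((Θ b).entry i j) = w i * b * star (w j) := hg
  refine ⟨StarAlgEquiv.ofBijective Θ ⟨?_, fun x => ?_⟩, hΘ⟩
  · rw [injective_iff_map_eq_zero]
    intro b hb
    have h1 : ∀ i j, w i * b * star (w j) = 0 := fun i j => by
      rw [← hΘ, hb, entry_zero, map_zero]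
    have h2 : ∀ i, w i * b = 0 := fun i => by
      obtain ⟨s, hs⟩ := hw' (w i * b)
      rw [← hs]
      exact Finset.sum_eq_zero fun j _ => by rw [← mul_assoc, h1, zero_mul]
    have h3 : star b = 0 := by
      obtain ⟨s, hs⟩ := hw' (star b)
      rw [← hs]
      exact Finset.sum_eq_zero fun j _ => by
        rw [← mul_assoc, ← FinMat.star_mul, h2, star_zero, zero_mul]
    rw [← star_star b, h3, star_zero]
  · refine ⟨∑ k ∈ Finset.range x.bound, ∑ l ∈ Finset.range x.bound,
      star (w k) * ψ (x.entry k l) * w l, ?_⟩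
    ext i j
    refine hψ ?_
    -- `ψ a` lies in the corner at `p`
    have hpψ : ∀ a, p * ψ a * p = ψ a := fun a => by
      rw [← hψp, ← map_mul, ← map_mul, one_mul, mul_one]
    have hterm : ∀ k l, w i * (star (w k) * ψ (x.entry k l) * w l) * star (w j) =
        if k = i then (if l = j then ψ (x.entry k l) else 0) else 0 := by
      intro k l
      have h1 : w i * (star (w k) * ψ (x.entry k l) * w l) * star (w j) =
          (w i * star (w k)) * ψ (x.entry k l) * (w l * star (w j)) := by simp only [mul_assoc]
      rw [h1, hw, hw]
      by_cases hk : k = i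
      · by_cases hl : l = j
        · simp [hk, hl, hpψ]
        · simp [hl]
      · simp [hk, Ne.symm hk]
    rw [hΘ]
    simp only [Finset.mul_sum, Finset.sum_mul, hterm]
    by_cases h : i < x.bound ∧ j < x.bound
    · rw [Finset.sum_eq_single_of_mem i (Finset.mem_range.mpr h.1) (fun k _ hk => by simp [hk]),
        Finset.sum_eq_single_of_mem j (Finset.mem_range.mpr h.2) (fun k _ hk => by simp [hk])]
      simp
    · rw [x.supp_bound i j (by omega), map_zero]
      refine Finset.sum_eq_zero fun k hk => Finset.sum_eq_zero fun l hl => ?_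
      rw [Finset.mem_range] at hk hl
      split_ifs with h1 h2
      · omega
      · rfl
      · rfl

end Corner

end FinMat

/-! ### Traces of projections are trace-scaling constants -/

section Main

variable {A : Type*} [CStarAlgebra A] [PartialOrder A] [StarOrderedRing A]

theorem FinMat.tr_star_mul_self_nonneg (τ : A →ₚ[ℂ] ℂ) (x : FinMat A) :
    0 ≤ FinMat.tr τ (star x * x) := by
  rw [FinMat.tr_eq_sum τ (x.supp_bound.star.mul x.supp_bound)]
  refine Finset.sum_nonneg fun i _ => map_nonneg τ ?_
  rw [FinMat.entry_mul_eq_sum (Or.inr x.supp_bound)]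
  exact Finset.sum_nonneg fun k _ => star_mul_self_nonneg _

/-- By uniqueness of the trace, a homomorphism from `A` to the finitely supported matrices pulls
their trace back to a multiple of the trace of `A`. -/
theorem tr_comp_eq_of_unique {τ : A →ₚ[ℂ] ℂ} (hτ : IsNormalizedTrace τ)
    (huniq : ∀ σ : A →ₚ[ℂ] ℂ, IsNormalizedTrace σ → σ = τ) (ψ : A →⋆ₙₐ[ℂ] FinMat A) {t : ℝ}
    (ht : 0 < t) (hψ : FinMat.tr τ (ψ 1) = t) (a : A) : FinMat.tr τ (ψ a) = t * τ a := by
  let f : A →ₗ[ℂ] ℂ :=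
    { toFun := fun a => (t⁻¹ : ℝ) * FinMat.tr τ (ψ a)
      map_add' := fun a b => by rw [map_add, map_add, mul_add]
      map_smul' := fun c a => by
        rw [map_smul, map_smul, smul_eq_mul, smul_eq_mul, RingHom.id_apply]; ring }
  let σ : A →ₚ[ℂ] ℂ := PositiveLinearMap.mk₀ f fun a ha => by
    obtain ⟨b, rfl⟩ := CStarAlgebra.nonneg_iff_eq_star_mul_self.mp ha
    change 0 ≤ ((t⁻¹ : ℝ) : ℂ) * FinMat.tr τ (ψ (star b * b))
    rw [map_mul, map_star]
    exact mul_nonneg (by exact_mod_cast (inv_pos.mpr ht).le)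
      (FinMat.tr_star_mul_self_nonneg τ _)
  have hσ : ∀ a, σ a = (t⁻¹ : ℝ) * FinMat.tr τ (ψ a) := fun a => rfl
  have htc : (t : ℂ) ≠ 0 := by exact_mod_cast ht.ne'
  have h := huniq σ ⟨by rw [hσ, hψ, Complex.ofReal_inv, inv_mul_cancel₀ htc], fun a b => by
    rw [hσ, hσ, map_mul ψ, map_mul ψ, FinMat.tr_mul_comm hτ.2]⟩
  have h2 : σ a = τ a := by rw [h]
  rw [← h2, hσ, ← mul_assoc, Complex.ofReal_inv, mul_inv_cancel₀ htc, one_mul]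

/-- A projection `p` with `p M_n(A) p ≅ A` is full, so infinitely many copies of `p` exhaust
`A ⊗ K(H)`; this identifies `A ⊗ K(H)` with `p M_n(A) p ⊗ K(H) ≅ A ⊗ K(H)`. -/
theorem fundamentalGroup_subset_traceScalingGroup (hA : IsSimpleCStarAlgebra A) {τ : A →ₚ[ℂ] ℂ}
    (hτ : IsNormalizedTrace τ) (huniq : ∀ σ : A →ₚ[ℂ] ℂ, IsNormalizedTrace σ → σ = τ) :
    fundamentalGroup τ ⊆ traceScalingGroup τ := by
  rintro t ⟨ht, n, q, hq, ⟨e⟩, hqt⟩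
  have hqq : q * q = q := hq.isIdempotentElem
  have hqs : star q = q := hq.isSelfAdjoint
  let ψ : A →⋆ₙₐ[ℂ] FinMat A := (FinMat.ofCorner (A := A) n).comp
    ((NonUnitalStarSubalgebraClass.subtype (projCorner hq)).comp
      (e.symm : A →⋆ₙₐ[ℂ] projCorner hq))
  have hψe : ∀ a, ψ a = FinMat.ofCorner n (e.symm a : CStarMatrix (Fin n) (Fin n) A) :=
    fun a => rfl
  have hψ : Function.Injective ψ := (FinMat.ofCorner_injective n).comp
    (Subtype.val_injective.comp e.symm.injective)
  set p := FinMat.ofCorner n q with hp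
  have hpp : p * p = p := by rw [hp, ← map_mul, hqq]
  have hps : star p = p := by rw [hp, ← map_star, hqs]
  have hψr : ∀ x, ∃ a, ψ a = p * x * p := by
    intro x
    have h1 : p * x * p = FinMat.ofCorner n (q * FinMat.corner n x * q) := by
      rw [map_mul, map_mul, ← FinMat.unit_mul_mul_unit, ← hp]
      have h2 : p * FinMat.unit A n = p := FinMat.mul_unit_of_supp (FinMat.supp_ofCorner n q)
      have h3 : FinMat.unit A n * p = p := FinMat.unit_mul_of_supp (FinMat.supp_ofCorner n q)
      simp only [mul_assoc]
      rw [h3, ← mul_assoc p (FinMat.unit A n), h2]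
    refine ⟨e ⟨q * FinMat.corner n x * q, _, rfl⟩, ?_⟩
    rw [hψe, StarAlgEquiv.symm_apply_apply, h1]
  -- the unit of `q M_n(A) q` is `q`
  have hψp : ψ 1 = p := by
    obtain ⟨a, ha⟩ := hψr p
    rw [hpp, hpp] at ha
    obtain ⟨y, hy⟩ := (e.symm 1).2
    have h1 : ψ 1 * p = ψ 1 := by
      rw [hψe, hy, hp, ← map_mul, mul_assoc, hqq]
    rw [← h1, ← ha, ← map_mul, one_mul]
  have hptr : FinMat.tr τ p = t := by rw [← hqt, matrixTrace_eq_tr]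
  have hp0 : p ≠ 0 := by
    intro h
    rw [h, map_zero] at hptr
    exact ht.ne' (by exact_mod_cast hptr.symm)
  obtain ⟨w, hw, hw'⟩ := FinMat.exists_partialIsometries hA hpp hps hp0
  obtain ⟨Θ, hΘ⟩ := FinMat.exists_starAlgEquiv ψ hψ hψp hψr w hw hw'
  refine mem_traceScalingGroup_of_tr hτ.2 ht Θ fun b => ?_
  have htr := tr_comp_eq_of_unique hτ huniq ψ ht (by rw [hψp, hptr])
  obtain ⟨s, hs⟩ := hw' b
  obtain ⟨m, hm⟩ := Finset.exists_nat_subset_range (s ∪ Finset.range (Θ b).bound)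
  have hsm : s ⊆ Finset.range m := Finset.subset_union_left.trans hm
  have hnm : FinMat.Supp m (Θ b) := (Θ b).supp_bound.mono
    (Finset.range_subset_range.mp (Finset.subset_union_right.trans hm))
  have h1 := (FinMat.sum_mul_eq_of_subset hw hs hsm).2
  rw [FinMat.tr_eq_sum τ hnm, Finset.mul_sum]
  nth_rewrite 1 [← h1]
  rw [map_sum]
  refine Finset.sum_congr rfl fun i _ => ?_
  rw [← htr, hΘ, ← mul_assoc, FinMat.tr_mul_comm hτ.2, mul_assoc]

end Main

end

theorem mainTheorem9 {A : Type*} [CStarAlgebra A] [PartialOrder A] [StarOrderedRing A]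
    (hA : IsSimpleCStarAlgebra A) (τ : A →ₚ[ℂ] ℂ) (hτ : IsNormalizedTrace τ)
    (huniq : ∀ σ : A →ₚ[ℂ] ℂ, IsNormalizedTrace σ → σ = τ) :
    fundamentalGroup τ = traceScalingGroup τ ∧
      ∃ G : Subgroup ℝˣ, traceScalingGroup τ = (fun u : ℝˣ => (u : ℝ)) '' (G : Set ℝˣ) :=
  ⟨(fundamentalGroup_subset_traceScalingGroup hA hτ huniq).antisymm
    (traceScalingGroup_subset_fundamentalGroup hτ), exists_subgroup_traceScalingGroup hτ.2⟩
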